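/- There are absolute constants $c_0, C_0, C_1 > 0$ such that the following holds for all integers $n, d \ge 1$, all $\boldsymbol{G}_1,\dots,\boldsymbol{G}_n \in \mathrm{O}(d) := \{\boldsymbol{O}\in\mathbb{R}^{d\times d} : \boldsymbol{O}\boldsymbol{O}^\top = \boldsymbol{O}^\top\boldsymbol{O} = \boldsymbol{I}_d\}$ and all real $\sigma \ge 0$ with $$\sigma < \frac{c_0\sqrt{n}}{\sqrt{d}\,(\sqrt{d}+\sqrt{\log n})}.$$ Let $\boldsymbol{G}^\top = [\boldsymbol{G}_1^\top,\dots,\boldsymbol{G}_n^\top] \in \mathbb{R}^{d\times nd}$ and $\boldsymbol{A} = \boldsymbol{G}\boldsymbol{G}^\top + \sigma\boldsymbol{W} \in \mathbb{R}^{nd\times nd}$, where $\boldsymbol{W}$ is a symmetric Gaussian random matrix: its entries on and above the diagonal are independent standard normal random variables. Write $\boldsymbol{X}_{ij}$ for the $(i,j)$-th $d\times d$ block of an $nd\times nd$ matrix $\boldsymbol{X}$ and $\langle \boldsymbol{X},\boldsymbol{Y}\rangle = \mathrm{Tr}(\boldsymbol{X}^\top\boldsymbol{Y})$. A maximum likelihood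 estimator (MLE) is a global maximizer $\widehat{\boldsymbol{G}} = (\widehat{\boldsymbol{G}}_1,\dots,\widehat{\boldsymbol{G}}_n)$ of $$\max_{\boldsymbol{R}_1,\dots,\boldsymbol{R}_n\in \mathrm{O}(d)}\ \sum_{i<j}\langle \boldsymbol{R}_i\boldsymbol{R}_j^\top, \boldsymbol{A}_{ij}\rangle .$$ Then, with probability at least $1 - C_1 n^{-2}$, the following statements hold together. (a) The semidefinite relaxation $$\max\ \langle \boldsymbol{A},\boldsymbol{X}\rangle \quad\text{such that}\quad \boldsymbol{X}\in\mathbb{R}^{nd\times nd},\ \boldsymbol{X}\succeq 0,\ \boldsymbol{X}_{ii} = \boldsymbol{I}_d \ (1\le i\le n)$$ is tight: it has exactly one solution $\boldsymbol{X}$; this solution has rank $d$; and it equals the MLE, that is, an MLE exists, and the MLEs are exactly those $\boldsymbol{R}\in\mathrm{O}(d)^n$ (stacked as an $nd\times d$ matrix) with $\boldsymbol{R}\boldsymbol{R}^\top = \boldsymbol{X}$. (b) Every MLE $\widehat{\boldsymbol{G}}$ satisfies $$\min_{\boldsymbol{Q}\in\mathrm{O}(d)}\max_{1\le i\le n}\|\widehat{\boldsymbol{G}}_i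 - \boldsymbol{G}_i\boldsymbol{Q}\|_F \le C_0\,\sigma\sqrt{n^{-1}d}\,(\sqrt{d}+\sqrt{\log n}).$$ -/

import Mathlib

open MeasureTheory ProbabilityTheory
open scoped Matrix Matrix.Norms.Frobenius

/-! Orthogonal group synchronization. A matrix of size `nd × nd` is indexed by `Fin n × Fin d`,
the first component being the block. The norm on matrices is the Frobenius norm. -/

namespace OrthSync

/-- The real matrices of size `nd × nd`, seen as `n × n` blocks of size `d × d`. -/
abbrev BigMatrix (n d : ℕ) := Matrix (Fin n × Fin d) (Fin n × Fin d) ℝ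

/-- The `(i, j)` block, of size `d × d`. -/
def block {n d : ℕ} (A : BigMatrix n d) (i j : Fin n) : Matrix (Fin d) (Fin d) ℝ :=
  Matrix.of fun a b => A (i, a) (j, b)

/-- `R Rᵀ` for the `nd × d` matrix `R` with blocks `R i`. Its `(i, j)` block is `R i * (R j)ᵀ`. -/
def gram {n d : ℕ} (R : Fin n → Matrix (Fin d) (Fin d) ℝ) : BigMatrix n d :=
  Matrix.of fun p q => (R p.1 * (R q.1)ᵀ) p.2 q.2

/-- The inner product `⟨X, Y⟩ = Tr (Xᵀ Y)` of two matrices of the same size. -/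
def matInner {m : Type*} [Fintype m] (X Y : Matrix m m ℝ) : ℝ := (Xᵀ * Y).trace

/-- `W` is a symmetric Gaussian random matrix: every entry is standard normal and the entries on
and above the diagonal are independent. The order of the rows and columns is lexicographic. -/
structure IsSymmGaussian {Ω : Type*} [MeasurableSpace Ω] {n d : ℕ}
    (W : Ω → BigMatrix n d) (P : Measure Ω) : Prop where
  symm : ∀ ω, (W ω).IsSymm
  law : ∀ p q, HasLaw (fun ω => W ω p q) (gaussianReal 0 1) P
  indep : iIndepFun
    (fun (e : {e : (Fin n × Fin d) × (Fin n × Fin d) // toLex e.1 ≤ toLex e.2}) ω =>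
      W ω e.1.1 e.1.2) P

/-- The data `A = G Gᵀ + σ W`. -/
def observation {n d : ℕ} (G : Fin n → Matrix (Fin d) (Fin d) ℝ) (σ : ℝ) (W : BigMatrix n d) :
    BigMatrix n d :=
  gram G + σ • W

/-- All blocks are orthogonal, i.e. `R ∈ O(d)^n`. -/
def IsOrth {n d : ℕ} (R : Fin n → Matrix (Fin d) (Fin d) ℝ) : Prop :=
  ∀ i, R i ∈ Matrix.orthogonalGroup (Fin d) ℝ

/-- The objective `∑_{i < j} ⟨R_i R_jᵀ, A_ij⟩` of the maximum likelihood problem. -/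
def mleObjective {n d : ℕ} (A : BigMatrix n d) (R : Fin n → Matrix (Fin d) (Fin d) ℝ) : ℝ :=
  ∑ i, ∑ j ∈ Finset.Ioi i, matInner (R i * (R j)ᵀ) (block A i j)

/-- `R` is a maximum likelihood estimator: a global maximizer of the objective over `O(d)^n`. -/
def IsMLE {n d : ℕ} (A : BigMatrix n d) (R : Fin n → Matrix (Fin d) (Fin d) ℝ) : Prop :=
  IsOrth R ∧ ∀ R', IsOrth R' → mleObjective A R' ≤ mleObjective A R

/-- Feasible points of the semidefinite relaxation: `X ⪰ 0` and `X_ii = I_d`. -/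
def IsFeasible {n d : ℕ} (X : BigMatrix n d) : Prop :=
  X.PosSemidef ∧ ∀ i, block X i i = 1

/-- `X` is a solution (global maximizer) of `max ⟨A, X⟩` subject to `X ⪰ 0` and `X_ii = I_d`. -/
def IsSDPSolution {n d : ℕ} (A X : BigMatrix n d) : Prop :=
  IsFeasible X ∧ ∀ Y, IsFeasible Y → matInner A Y ≤ matInner A X

/-- Tightness: the relaxation has exactly one solution `X`, its rank is `d`, and it equals the
maximum likelihood estimator: the maximum likelihood estimators exist and are exactly the
`R ∈ O(d)^n` with `R Rᵀ = X` (so they form one orbit of the global action of `O(d)`). -/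
def IsTight {n d : ℕ} (A : BigMatrix n d) : Prop :=
  ∃ X, IsSDPSolution A X ∧ (∀ Y, IsSDPSolution A Y → Y = X) ∧ X.rank = d ∧
    (∃ R, IsMLE A R) ∧ ∀ R, IsMLE A R ↔ IsOrth R ∧ gram R = X

/-- `min_{Q ∈ O(d)} max_i ‖R_i - G_i Q‖_F ≤ b`. -/
def BlockErrorLE {n d : ℕ} (R G : Fin n → Matrix (Fin d) (Fin d) ℝ) (b : ℝ) : Prop :=
  ∃ Q ∈ Matrix.orthogonalGroup (Fin d) ℝ, ∀ i, ‖R i - G i * Q‖ ≤ b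

end OrthSync

/-! Write `N = σW`. It suffices to find an orthogonal stack `R` with `A R = Λ R`, where `Λ` is block
diagonal and symmetric and `Λ - A` is positive definite on the orthogonal complement of the columns
of `R`. Then `Λ - A` is a dual certificate, and it forces uniqueness, rank `d` and the description
of all MLEs (`isTight_of_certificate`).

Such an `R` is a fixed point of the blockwise polar factor of `A R`, but that map commutes with `R ↦
R Q` and cannot contract. Two changes repair it. Replacing `Gᵀ R` by its symmetric part `gauge G R`
removes the rotational freedom: near `G` this part is constant up to second order in `R - G`.
Clipping the blocks of `N R` at radius `n/8` keeps every polar factor well conditioned even when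
nothing is known about individual block rows of the noise. The modified map contracts by `1/2` as
soon as the operator norm of `N` is small (`exists_isClippedFix`), and its fixed point is Lipschitz
in `N` (`IsClippedFix.norm_sub_le`). Where the clipping is inactive, symmetry of `Rᵀ N R` forces `Gᵀ
R` to be symmetric, so both changes disappear and `A R = Λ R` (`IsClippedFix.isTight_and_error`).

Inactivity of the clipping means `‖(N R)_i‖` is small for all `i`, although `R` depends on `N`.
Leave-one-out decouples them: the fixed point `S` for the noise without block row and column `i` is
independent of that row, so `(N S)_i` is Gaussian given `S`, and stability transfers the bound from
`S` to `R` (`IsClippedFix.norm_blk_mul_le`). The union over the `n` blocks is the source of `√(log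
n)`.

The random input is thus an operator norm bound and `n` row bounds. Both follow from pointwise
Gaussian tails by averaging over a ball (`measure_le_of_forall_ball`), in place of a net. -/

namespace OrthSync

/-! ### Frobenius norm, traces and positive semidefinite forms. -/

section Frobenius

variable {m n k : Type*} [Fintype m] [Fintype n] [Fintype k]

theorem frobenius_norm_sq (A : Matrix m n ℝ) : ‖A‖ ^ 2 = ∑ i, ∑ j, A i j ^ 2 := by
  rw [Matrix.frobenius_norm_def, ← Real.sqrt_eq_rpow, Real.sq_sqrt]
  · simp [sq_abs]
  · positivity

theorem trace_transpose_mul_eq_sum (A B : Matrix m n ℝ) :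
    (Aᵀ * B).trace = ∑ i, ∑ j, A i j * B i j := by
  simp only [Matrix.trace, Matrix.diag, Matrix.mul_apply, Matrix.transpose_apply]
  exact Finset.sum_comm

theorem frobenius_norm_sq_eq_trace (A : Matrix m n ℝ) : ‖A‖ ^ 2 = (Aᵀ * A).trace := by
  rw [frobenius_norm_sq, trace_transpose_mul_eq_sum]
  simp [sq]

theorem trace_transpose_mul_le (A B : Matrix m n ℝ) : (Aᵀ * B).trace ≤ ‖A‖ * ‖B‖ := by
  rw [trace_transpose_mul_eq_sum]
  refine (abs_le.1 (abs_le_of_sq_le_sq ?_ (by positivity))).2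
  rw [mul_pow, frobenius_norm_sq, frobenius_norm_sq]
  simp only [← Finset.sum_product']
  exact Finset.sum_mul_sq_le_sq_mul_sq _ _ _

theorem trace_mul_transpose_le (A B : Matrix m n ℝ) : (A * Bᵀ).trace ≤ ‖A‖ * ‖B‖ := by
  rw [Matrix.trace_mul_comm, mul_comm ‖A‖]
  exact trace_transpose_mul_le B A

theorem frobenius_norm_sq_mul_left [DecidableEq n] {c : ℝ} {U : Matrix m n ℝ} (hU : Uᵀ * U = c • 1)
    (A : Matrix n k ℝ) : ‖U * A‖ ^ 2 = c * ‖A‖ ^ 2 := by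
  rw [frobenius_norm_sq_eq_trace, frobenius_norm_sq_eq_trace, Matrix.transpose_mul,
    Matrix.mul_assoc, ← Matrix.mul_assoc Uᵀ, hU]
  simp

theorem frobenius_norm_orth_mul [DecidableEq n] {U : Matrix m n ℝ} (hU : Uᵀ * U = 1)
    (A : Matrix n k ℝ) : ‖U * A‖ = ‖A‖ := by
  have h := frobenius_norm_sq_mul_left (c := 1) (by simpa using hU) A
  rw [one_mul] at h
  exact (sq_eq_sq₀ (norm_nonneg _) (norm_nonneg _)).1 h

theorem frobenius_norm_mul_orth [DecidableEq n] {U : Matrix n n ℝ} (hU : U * Uᵀ = 1)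
    (A : Matrix m n ℝ) : ‖A * U‖ = ‖A‖ := by
  rw [← Matrix.frobenius_norm_transpose, Matrix.transpose_mul,
    frobenius_norm_orth_mul (by simpa using hU), Matrix.frobenius_norm_transpose]

theorem frobenius_norm_sq_orth [DecidableEq n] {U : Matrix m n ℝ} {c : ℝ} (hU : Uᵀ * U = c • 1) :
    ‖U‖ ^ 2 = c * Fintype.card n := by
  rw [frobenius_norm_sq_eq_trace, hU]
  simp

theorem posSemidef_real_iff {A : Matrix n n ℝ} :
    A.PosSemidef ↔ Aᵀ = A ∧ ∀ x : n → ℝ, 0 ≤ x ⬝ᵥ (A *ᵥ x) := by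
  rw [Matrix.posSemidef_iff_dotProduct_mulVec, Matrix.IsHermitian,
    Matrix.conjTranspose_eq_transpose_of_trivial]
  simp

theorem trace_conj_nonneg {A : Matrix n n ℝ} (hA : A.PosSemidef) (X : Matrix n k ℝ) :
    0 ≤ (Xᵀ * A * X).trace := by
  have := (hA.conjTranspose_mul_mul_same X).trace_nonneg
  rwa [Matrix.conjTranspose_eq_transpose_of_trivial] at this

theorem dotProduct_mulVec_le (A : Matrix m n ℝ) (x : n → ℝ) :
    (A *ᵥ x) ⬝ᵥ (A *ᵥ x) ≤ ‖A‖ ^ 2 * (x ⬝ᵥ x) := by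
  rw [frobenius_norm_sq, Finset.sum_mul]
  simp only [dotProduct, ← sq, Matrix.mulVec]
  exact Finset.sum_le_sum fun i _ => Finset.sum_mul_sq_le_sq_mul_sq _ _ _

end Frobenius

/-! ### Polar factors: existence and Lipschitz stability. -/

section Orthogonal

variable {k : Type*} [Fintype k] [DecidableEq k]

theorem orth_mul_transpose {U : Matrix k k ℝ} (hU : U ∈ Matrix.orthogonalGroup k ℝ) :
    U * Uᵀ = 1 := by
  simpa [Matrix.star_eq_conjTranspose] using (Matrix.mem_orthogonalGroup_iff k ℝ).1 hU

theorem orth_transpose_mul {U : Matrix k k ℝ} (hU : U ∈ Matrix.orthogonalGroup k ℝ) :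
    Uᵀ * U = 1 := by
  simpa [Matrix.star_eq_conjTranspose] using (Matrix.mem_orthogonalGroup_iff' k ℝ).1 hU

theorem mem_orthogonalGroup_of_mul_transpose {U : Matrix k k ℝ} (hU : U * Uᵀ = 1) :
    U ∈ Matrix.orthogonalGroup k ℝ := by
  rw [Matrix.mem_orthogonalGroup_iff]
  simpa [Matrix.star_eq_conjTranspose] using hU

/-- `U` is an orthogonal polar factor of `M = Λ U` and `Λ ⪰ ℓ I`. -/
def IsPolar (ℓ : ℝ) (M U : Matrix k k ℝ) : Prop :=
  U ∈ Matrix.orthogonalGroup k ℝ ∧ (M * Uᵀ - ℓ • (1 : Matrix k k ℝ)).PosSemidef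

theorem IsPolar.symm {ℓ : ℝ} {M U : Matrix k k ℝ} (h : IsPolar ℓ M U) :
    (M * Uᵀ)ᵀ = M * Uᵀ := by
  have := (posSemidef_real_iff.1 h.2).1
  simpa [Matrix.transpose_sub] using this

/-- The polar factor maximizes `V ↦ tr (M Vᵀ)` over the orthogonal group, with quadratic growth: for
`M = Λ U`, twice the right side is `tr ((U - V)ᵀ Λ (U - V))`. -/
theorem IsPolar.half_le {ℓ : ℝ} {M U V : Matrix k k ℝ} (h : IsPolar ℓ M U)
    (hV : V ∈ Matrix.orthogonalGroup k ℝ) :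
    ℓ / 2 * ‖U - V‖ ^ 2 ≤ (M * (U - V)ᵀ).trace := by
  set Λ := M * Uᵀ with hΛ
  have hM : M = Λ * U := by rw [hΛ, Matrix.mul_assoc, orth_transpose_mul h.1, Matrix.mul_one]
  have hsymm : Λᵀ = Λ := h.symm
  have h1 := trace_conj_nonneg h.2 (U - V)
  rw [← hΛ, Matrix.mul_sub (U - V)ᵀ Λ, Matrix.sub_mul _ _ (U - V), Matrix.trace_sub, Matrix.mul_smul, Matrix.mul_one,
    Matrix.smul_mul, Matrix.trace_smul, ← frobenius_norm_sq_eq_trace, smul_eq_mul] at h1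
  have h2 : ((U - V)ᵀ * Λ * (U - V)).trace = 2 * (M * (U - V)ᵀ).trace := by
    rw [Matrix.trace_mul_comm, ← Matrix.mul_assoc]
    have e1 : (U - V) * (U - V)ᵀ = 1 + 1 - V * Uᵀ - U * Vᵀ := by
      rw [Matrix.transpose_sub, Matrix.sub_mul, Matrix.mul_sub, Matrix.mul_sub,
        orth_mul_transpose h.1, orth_mul_transpose hV]
      abel
    have e2 : (V * Uᵀ * Λ).trace = (U * Vᵀ * Λ).trace := by
      rw [← Matrix.trace_transpose, Matrix.transpose_mul _ Λ, hsymm, Matrix.transpose_mul,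
        Matrix.transpose_transpose, Matrix.trace_mul_comm]
    have e3 : (U * Vᵀ * Λ).trace = (V * Uᵀ * Λ).trace := e2.symm
    have e4 : (M * Vᵀ).trace = (V * Uᵀ * Λ).trace := by
      rw [e2, hM, Matrix.mul_assoc, Matrix.trace_mul_comm]
    rw [e1]
    simp only [Matrix.sub_mul, Matrix.add_mul, Matrix.trace_sub, Matrix.trace_add, Matrix.one_mul,
      Matrix.transpose_sub, Matrix.mul_sub, e3, e4, ← hΛ]
    ring
  linarith

/-- Add the quadratic growth inequalities of the two maximization problems and apply Cauchy–Schwarz.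
-/
theorem IsPolar.norm_sub_le {ℓ : ℝ} {M M' U U' : Matrix k k ℝ} (h : IsPolar ℓ M U)
    (h' : IsPolar ℓ M' U') : ℓ * ‖U - U'‖ ≤ ‖M - M'‖ := by
  have h1 := h.half_le h'.1
  have h2 := h'.half_le h.1
  have h3 := trace_mul_transpose_le (M - M') (U - U')
  have h4 : ((M - M') * (U - U')ᵀ).trace = (M * (U - U')ᵀ).trace + (M' * (U' - U)ᵀ).trace := by
    rw [← neg_sub U U', Matrix.transpose_neg, Matrix.mul_neg, Matrix.trace_neg, Matrix.sub_mul,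
      Matrix.trace_sub]
    ring
  rw [norm_sub_rev U' U] at h2
  have h5 : (ℓ * ‖U - U'‖) * ‖U - U'‖ ≤ ‖M - M'‖ * ‖U - U'‖ := by nlinarith
  rcases (norm_nonneg (U - U')).eq_or_lt with h0 | h0
  · rw [← h0]; simp
  · exact le_of_mul_le_mul_right h5 h0

theorem isPolar_smul_self {ℓ c : ℝ} (h : ℓ ≤ c) {G : Matrix k k ℝ}
    (hG : G ∈ Matrix.orthogonalGroup k ℝ) : IsPolar ℓ (c • G) G := by
  refine ⟨hG, ?_⟩
  rw [Matrix.smul_mul, orth_mul_transpose hG, ← sub_smul]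
  exact Matrix.PosSemidef.one.smul (sub_nonneg.2 h)

open scoped MatrixOrder in
-- With `P = √(M Mᵀ)` the factor is `P⁻¹ M`. The hypothesis says `P² ⪰ ℓ²`; testing it on
-- eigenvectors of `P - ℓ` gives `P ⪰ ℓ`.
theorem exists_isPolar {ℓ : ℝ} (hℓ : 0 < ℓ) {M : Matrix k k ℝ}
    (hM : ∀ x : k → ℝ, ℓ ^ 2 * (x ⬝ᵥ x) ≤ (Mᵀ *ᵥ x) ⬝ᵥ (Mᵀ *ᵥ x)) : ∃ U, IsPolar ℓ M U := by
  have hMM : (M * Mᵀ).PosSemidef := by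
    simpa [Matrix.conjTranspose_eq_transpose_of_trivial] using
      Matrix.posSemidef_self_mul_conjTranspose M
  set P := CFC.sqrt (M * Mᵀ) with hP
  have hP0 : P.PosSemidef := Matrix.nonneg_iff_posSemidef.1 (CFC.sqrt_nonneg (M * Mᵀ))
  have hPP : P * P = M * Mᵀ := CFC.sqrt_mul_sqrt_self _ hMM.nonneg
  have hPt : Pᵀ = P := (posSemidef_real_iff.1 hP0).1
  have hsub : (P - ℓ • (1 : Matrix k k ℝ)).PosSemidef := by
    have hh : (P - ℓ • (1 : Matrix k k ℝ)).IsHermitian := by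
      rw [Matrix.IsHermitian, Matrix.conjTranspose_eq_transpose_of_trivial]
      simp [hPt]
    rw [hh.posSemidef_iff_eigenvalues_nonneg]
    intro i
    set μ := hh.eigenvalues i
    set v : k → ℝ := (hh.eigenvectorBasis i).ofLp
    have hv : (P - ℓ • (1 : Matrix k k ℝ)) *ᵥ v = μ • v := hh.mulVec_eigenvectorBasis i
    have hv1 : v ⬝ᵥ v = 1 := by
      have h := hh.eigenvectorBasis.orthonormal.1 i
      have h2 := EuclideanSpace.real_norm_sq_eq (hh.eigenvectorBasis i)
      rw [h] at h2
      simp only [dotProduct, ← sq]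
      simpa using h2.symm
    have hPv : P *ᵥ v = (ℓ + μ) • v := by
      rw [Matrix.sub_mulVec, Matrix.smul_mulVec, Matrix.one_mulVec, sub_eq_iff_eq_add] at hv
      rw [hv, add_smul, add_comm]
    have h0 : 0 ≤ ℓ + μ := by
      have := (posSemidef_real_iff.1 hP0).2 v
      rwa [hPv, dotProduct_smul, hv1, smul_eq_mul, mul_one] at this
    have h1 : ℓ ^ 2 ≤ (ℓ + μ) ^ 2 := by
      have h2 := hM v
      have h3 : (Mᵀ *ᵥ v) ⬝ᵥ (Mᵀ *ᵥ v) = (P *ᵥ v) ⬝ᵥ (P *ᵥ v) := by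
        rw [Matrix.dotProduct_mulVec, Matrix.vecMul_transpose, Matrix.mulVec_mulVec, ← hPP,
          ← Matrix.mulVec_mulVec, dotProduct_comm, Matrix.dotProduct_mulVec,
          ← Matrix.mulVec_transpose, hPt]
      rw [h3, hPv, hv1] at h2
      simp only [dotProduct_smul, smul_dotProduct, hv1, smul_eq_mul] at h2
      nlinarith
    change 0 ≤ μ
    have := (abs_le.1 (abs_le_of_sq_le_sq h1 h0)).2
    linarith
  have hdet : IsUnit P.det := by
    have : P.PosDef := by
      have h1 : (ℓ • (1 : Matrix k k ℝ)).PosDef := Matrix.PosDef.one.smul hℓ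
      simpa using h1.add_posSemidef hsub
    exact this.isUnit.map Matrix.detMonoidHom
  refine ⟨P⁻¹ * M, ?_, ?_⟩
  · apply mem_orthogonalGroup_of_mul_transpose
    rw [Matrix.transpose_mul, Matrix.transpose_nonsing_inv, hPt, Matrix.mul_assoc,
      ← Matrix.mul_assoc M, ← hPP, Matrix.mul_assoc, Matrix.mul_nonsing_inv _ hdet, Matrix.mul_one,
      Matrix.nonsing_inv_mul _ hdet]
  · rw [Matrix.transpose_mul, Matrix.transpose_nonsing_inv, hPt,
      ← Matrix.mul_assoc M, ← hPP, Matrix.mul_assoc, Matrix.mul_nonsing_inv _ hdet, Matrix.mul_one]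
    exact hsub

theorem exists_isPolar_of_norm_sub_le {c : ℝ} (hc : 0 < c) {M G : Matrix k k ℝ}
    (hG : G ∈ Matrix.orthogonalGroup k ℝ) (h : ‖M - c • G‖ ≤ c / 4) :
    ∃ U, IsPolar (3 / 4 * c) M U := by
  refine exists_isPolar (by positivity) fun x => ?_
  set E := (M - c • G)ᵀ with hE
  have hMt : Mᵀ = c • Gᵀ + E := by rw [hE, Matrix.transpose_sub, Matrix.transpose_smul]; abel
  have hEn : ‖E‖ ≤ c / 4 := by rwa [hE, Matrix.frobenius_norm_transpose]
  have hE2 := dotProduct_mulVec_le E x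
  have hx : 0 ≤ x ⬝ᵥ x := by
    simp only [dotProduct, ← sq]; positivity
  have hE3 : (E *ᵥ x) ⬝ᵥ (E *ᵥ x) ≤ (c / 4) ^ 2 * (x ⬝ᵥ x) :=
    hE2.trans (mul_le_mul_of_nonneg_right (pow_le_pow_left₀ (norm_nonneg _) hEn 2) hx)
  set y := Gᵀ *ᵥ x with hy
  have hyy : y ⬝ᵥ y = x ⬝ᵥ x := by
    rw [hy, Matrix.dotProduct_mulVec, Matrix.vecMul_transpose, Matrix.mulVec_mulVec,
      orth_mul_transpose hG, Matrix.one_mulVec]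
  set z := E *ᵥ x with hz
  have hMx : Mᵀ *ᵥ x = c • y + z := by rw [hMt, Matrix.add_mulVec, Matrix.smul_mulVec]
  have hexp : (c • y + z) ⬝ᵥ (c • y + z) = c ^ 2 * (y ⬝ᵥ y) + 2 * c * (y ⬝ᵥ z) + z ⬝ᵥ z := by
    simp only [add_dotProduct, dotProduct_add, smul_dotProduct, dotProduct_smul, smul_eq_mul]
    rw [dotProduct_comm z y]; ring
  -- Cauchy–Schwarz for `y ⬝ᵥ z` in the form that is sharp when `‖z‖ = (c/4) ‖y‖`; four times this
  -- inequality leaves `1 - 4/16 - 3/16 = (3/4)²`.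
  have hcs : 0 ≤ ((c / 4) • y + z) ⬝ᵥ ((c / 4) • y + z) := by
    simp only [dotProduct, ← sq]; positivity
  have hexp2 : ((c / 4) • y + z) ⬝ᵥ ((c / 4) • y + z)
      = (c / 4) ^ 2 * (y ⬝ᵥ y) + c / 2 * (y ⬝ᵥ z) + z ⬝ᵥ z := by
    simp only [add_dotProduct, dotProduct_add, smul_dotProduct, dotProduct_smul, smul_eq_mul]
    rw [dotProduct_comm z y]; ring
  rw [hMx, hexp, hyy]
  rw [hexp2, hyy] at hcs
  nlinarith
end Orthogonal

/-- Matrices of size `nd × d`. -/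
abbrev Stack (n d : ℕ) := Matrix (Fin n × Fin d) (Fin d) ℝ

/-- The `i`-th block of an `nd × d` matrix. -/
def blk {n d : ℕ} (R : Stack n d) (i : Fin n) : Matrix (Fin d) (Fin d) ℝ :=
  Matrix.of fun a b => R (i, a) b

/-- The `nd × d` matrix with prescribed blocks. -/
def stack {n d : ℕ} (R : Fin n → Matrix (Fin d) (Fin d) ℝ) : Stack n d :=
  Matrix.of fun p b => R p.1 p.2 b

/-! ### Block columns. -/

section Stack

variable {n d : ℕ}

@[simp] theorem blk_stack (R : Fin n → Matrix (Fin d) (Fin d) ℝ) (i : Fin n) :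
    blk (stack R) i = R i := rfl

@[simp] theorem stack_blk (R : Stack n d) : stack (blk R) = R := rfl

theorem blk_add (R S : Stack n d) (i : Fin n) : blk (R + S) i = blk R i + blk S i := rfl

theorem blk_smul (c : ℝ) (R : Stack n d) (i : Fin n) : blk (c • R) i = c • blk R i := rfl

theorem norm_sq_eq_sum_blk (R : Stack n d) : ‖R‖ ^ 2 = ∑ i, ‖blk R i‖ ^ 2 := by
  simp only [frobenius_norm_sq, Fintype.sum_prod_type]
  rfl

theorem norm_blk_le (R : Stack n d) (i : Fin n) : ‖blk R i‖ ≤ ‖R‖ := by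
  refine (sq_le_sq₀ (norm_nonneg _) (norm_nonneg _)).1 ?_
  rw [norm_sq_eq_sum_blk R]
  exact Finset.single_le_sum (f := fun i => ‖blk R i‖ ^ 2) (fun _ _ => sq_nonneg _)
    (Finset.mem_univ i)

theorem norm_le_of_blk_le {R S : Stack n d} {c : ℝ} (hc : 0 ≤ c)
    (h : ∀ i, ‖blk R i‖ ≤ c * ‖blk S i‖) : ‖R‖ ≤ c * ‖S‖ := by
  refine (sq_le_sq₀ (norm_nonneg _) (by positivity)).1 ?_
  rw [mul_pow, norm_sq_eq_sum_blk, norm_sq_eq_sum_blk, Finset.mul_sum]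
  refine Finset.sum_le_sum fun i _ => ?_
  rw [← mul_pow]
  exact pow_le_pow_left₀ (norm_nonneg _) (h i) 2

theorem transpose_mul_eq_sum_blk (R S : Stack n d) : Rᵀ * S = ∑ i, (blk R i)ᵀ * blk S i := by
  ext a b
  simp only [Matrix.mul_apply, Matrix.transpose_apply, Fintype.sum_prod_type, Matrix.sum_apply]
  rfl

theorem IsOrth.transpose_mul_self {R : Stack n d} (h : IsOrth (blk R)) : Rᵀ * R = (n : ℝ) • 1 := by
  rw [transpose_mul_eq_sum_blk, Finset.sum_congr rfl fun i _ => orth_transpose_mul (h i)]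
  simp [← Nat.cast_smul_eq_nsmul ℝ]

theorem IsOrth.norm_sq {R : Stack n d} (h : IsOrth (blk R)) : ‖R‖ ^ 2 = n * d := by
  simpa using frobenius_norm_sq_orth h.transpose_mul_self

theorem IsOrth.norm_eq {R : Stack n d} (h : IsOrth (blk R)) : ‖R‖ = √n * √d := by
  rw [← Real.sqrt_mul (Nat.cast_nonneg n), ← h.norm_sq, Real.sqrt_sq (norm_nonneg _)]

theorem IsOrth.norm_blk_sq {R : Stack n d} (h : IsOrth (blk R)) (i : Fin n) :
    ‖blk R i‖ ^ 2 = d := by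
  have := frobenius_norm_sq_orth (c := 1) (by simpa using orth_transpose_mul (h i))
  simpa using this

theorem IsOrth.norm_mul {R : Stack n d} (h : IsOrth (blk R)) (X : Matrix (Fin d) (Fin d) ℝ) :
    ‖R * X‖ = √n * ‖X‖ := by
  rw [← sq_eq_sq₀ (norm_nonneg _) (by positivity), mul_pow, Real.sq_sqrt (Nat.cast_nonneg n)]
  exact frobenius_norm_sq_mul_left h.transpose_mul_self X

theorem gram_eq (R : Fin n → Matrix (Fin d) (Fin d) ℝ) : gram R = stack R * (stack R)ᵀ := rfl

end Stack

/-! ### Operator norm bounds through quadratic forms. -/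

section OpBound

/-- The quadratic form of `N` is bounded by `ν` times the identity. -/
def OpBound {m : Type*} [Fintype m] (N : Matrix m m ℝ) (ν : ℝ) : Prop :=
  ∀ x : m → ℝ, |x ⬝ᵥ (N *ᵥ x)| ≤ ν * (x ⬝ᵥ x)

variable {m k : Type*} [Fintype m] [Fintype k]

theorem OpBound.abs_trace_le {N : Matrix m m ℝ} {ν : ℝ} (h : OpBound N ν) (X : Matrix m k ℝ) :
    |(Xᵀ * (N * X)).trace| ≤ ν * ‖X‖ ^ 2 := by
  have e1 : (Xᵀ * (N * X)).trace = ∑ j, X.col j ⬝ᵥ (N *ᵥ X.col j) := by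
    simp only [Matrix.trace, Matrix.diag, Matrix.mul_apply, dotProduct, Matrix.mulVec,
      Matrix.transpose_apply, Matrix.col_apply]
  have e2 : ‖X‖ ^ 2 = ∑ j, X.col j ⬝ᵥ X.col j := by
    rw [frobenius_norm_sq, Finset.sum_comm]
    simp only [dotProduct, Matrix.col_apply, sq]
  rw [e1, e2, Finset.mul_sum]
  exact (Finset.abs_sum_le_sum_abs _ _).trans (Finset.sum_le_sum fun j _ => h _)

/-- Polarization: compare the form at `X + Y` and at `X - Y`, then use the parallelogram law. -/
theorem OpBound.trace_bilin_le {N : Matrix m m ℝ} {ν : ℝ} (h : OpBound N ν) (hN : Nᵀ = N)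
    (X Y : Matrix m k ℝ) : 2 * (Xᵀ * (N * Y)).trace ≤ ν * (‖X‖ ^ 2 + ‖Y‖ ^ 2) := by
  have h1 := (abs_le.1 (h.abs_trace_le (X + Y))).2
  have h2 := (abs_le.1 (h.abs_trace_le (X - Y))).1
  have hs : (Yᵀ * (N * X)).trace = (Xᵀ * (N * Y)).trace := by
    rw [← Matrix.trace_transpose, Matrix.transpose_mul, Matrix.transpose_mul, hN,
      Matrix.transpose_transpose, Matrix.mul_assoc]
  have par : ‖X + Y‖ ^ 2 + ‖X - Y‖ ^ 2 = 2 * (‖X‖ ^ 2 + ‖Y‖ ^ 2) := by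
    simp only [frobenius_norm_sq, ← Finset.sum_add_distrib, Finset.mul_sum, Matrix.add_apply,
      Matrix.sub_apply]
    refine Finset.sum_congr rfl fun i _ => Finset.sum_congr rfl fun j _ => by ring
  simp only [Matrix.transpose_add, Matrix.transpose_sub, Matrix.add_mul, Matrix.sub_mul,
    Matrix.mul_add, Matrix.mul_sub, Matrix.trace_add, Matrix.trace_sub, hs] at h1 h2
  have par' : ν * ‖X + Y‖ ^ 2 + ν * ‖X - Y‖ ^ 2 = 2 * (ν * (‖X‖ ^ 2 + ‖Y‖ ^ 2)) := by
    rw [← mul_add, par]; ring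
  linarith

theorem OpBound.norm_mul_le {N : Matrix m m ℝ} {ν : ℝ} (h : OpBound N ν) (hN : Nᵀ = N)
    (hν : 0 ≤ ν) (X : Matrix m k ℝ) : ‖N * X‖ ≤ ν * ‖X‖ := by
  have key : ∀ t : ℝ, 2 * t * ‖N * X‖ ^ 2 ≤ ν * (t ^ 2 * ‖N * X‖ ^ 2 + ‖X‖ ^ 2) := by
    intro t
    have := h.trace_bilin_le hN (t • (N * X)) X
    rw [norm_smul, mul_pow, Real.norm_eq_abs, sq_abs, Matrix.transpose_smul, Matrix.smul_mul,
      Matrix.trace_smul, ← frobenius_norm_sq_eq_trace, smul_eq_mul] at this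
    linarith
  rcases hν.eq_or_lt with h0 | h0
  · have := key 1
    rw [← h0] at this ⊢
    nlinarith [norm_nonneg (N * X)]
  · refine (sq_le_sq₀ (norm_nonneg _) (by positivity)).1 ?_
    -- This `t` balances the two terms on the right of `key`.
    have := key ν⁻¹
    have e : ν * (ν⁻¹ ^ 2 * ‖N * X‖ ^ 2 + ‖X‖ ^ 2) = ν⁻¹ * ‖N * X‖ ^ 2 + ν * ‖X‖ ^ 2 := by
      field_simp
    rw [e] at this
    have h2 : ν⁻¹ * ‖N * X‖ ^ 2 ≤ ν * ‖X‖ ^ 2 := by linarith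
    rw [inv_mul_le_iff₀ h0] at h2
    linarith [mul_pow ν ‖X‖ 2]

theorem OpBound.smul {N : Matrix m m ℝ} {ν c : ℝ} (h : OpBound N ν) (hc : 0 ≤ c) :
    OpBound (c • N) (c * ν) := by
  intro x
  rw [Matrix.smul_mulVec, dotProduct_smul, smul_eq_mul, abs_mul, abs_of_nonneg hc, mul_assoc]
  exact mul_le_mul_of_nonneg_left (h x) hc

end OpBound

/-! ### Radial clipping. -/

section Clip

variable {E : Type*} [NormedAddCommGroup E] [NormedSpace ℝ E]

/-- Radial projection onto the closed ball of radius `r`. -/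
noncomputable def clip (r : ℝ) (x : E) : E := (r / max r ‖x‖) • x

theorem clip_of_norm_le {r : ℝ} (hr : 0 < r) {x : E} (h : ‖x‖ ≤ r) : clip r x = x := by
  rw [clip, max_eq_left h, div_self hr.ne', one_smul]

theorem norm_clip_le {r : ℝ} (hr : 0 < r) (x : E) : ‖clip r x‖ ≤ r := by
  have hm : 0 < max r ‖x‖ := lt_max_of_lt_left hr
  rw [clip, norm_smul, Real.norm_of_nonneg (by positivity), div_mul_eq_mul_div, div_le_iff₀ hm]
  exact mul_le_mul_of_nonneg_left (le_max_right _ _) hr.le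

theorem norm_clip_le_norm {r : ℝ} (hr : 0 < r) (x : E) : ‖clip r x‖ ≤ ‖x‖ := by
  have hm : 0 < max r ‖x‖ := lt_max_of_lt_left hr
  rw [clip, norm_smul, Real.norm_of_nonneg (by positivity)]
  exact mul_le_of_le_one_left (norm_nonneg _) ((div_le_one hm).2 (le_max_left _ _))

theorem norm_clip_sub_clip_le {r : ℝ} (hr : 0 < r) (x y : E) :
    ‖clip r x - clip r y‖ ≤ 2 * ‖x - y‖ := by
  have hx : 0 < max r ‖x‖ := lt_max_of_lt_left hr
  have hy : 0 < max r ‖y‖ := lt_max_of_lt_left hr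
  have e : clip r x - clip r y
      = (r / max r ‖x‖) • (x - y) + (r / max r ‖x‖ - r / max r ‖y‖) • y := by
    simp only [clip, smul_sub, sub_smul]; abel
  have h1 : ‖(r / max r ‖x‖) • (x - y)‖ ≤ ‖x - y‖ := by
    rw [norm_smul, Real.norm_of_nonneg (by positivity)]
    exact mul_le_of_le_one_left (norm_nonneg _) ((div_le_one hx).2 (le_max_left _ _))
  have h2 : ‖(r / max r ‖x‖ - r / max r ‖y‖) • y‖ ≤ ‖x - y‖ := by
    have hd : r / max r ‖x‖ - r / max r ‖y‖
        = (r / max r ‖x‖) * ((max r ‖y‖ - max r ‖x‖) / max r ‖y‖) := by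
      field_simp
    rw [norm_smul, hd, norm_mul, Real.norm_of_nonneg (show 0 ≤ r / max r ‖x‖ by positivity),
      norm_div, Real.norm_of_nonneg hy.le, Real.norm_eq_abs]
    have h3 : |max r ‖y‖ - max r ‖x‖| ≤ ‖x - y‖ := by
      have := abs_max_sub_max_le_max r ‖y‖ r ‖x‖
      rw [sub_self, abs_zero, max_eq_right (abs_nonneg (‖y‖ - ‖x‖))] at this
      refine this.trans ?_
      rw [norm_sub_rev]
      exact abs_norm_sub_norm_le y x
    have h4 : |max r ‖y‖ - max r ‖x‖| / max r ‖y‖ * ‖y‖ ≤ ‖x - y‖ := by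
      rw [div_mul_eq_mul_div, div_le_iff₀ hy]
      exact mul_le_mul h3 (le_max_right _ _) (norm_nonneg _) (norm_nonneg _)
    rw [mul_assoc]
    exact (mul_le_of_le_one_left (by positivity) ((div_le_one hx).2 (le_max_left _ _))).trans h4
  rw [e]
  refine (norm_add_le _ _).trans ?_
  linarith

variable {n d : ℕ}

/-- Blockwise radial projection. -/
noncomputable def clipStack (r : ℝ) (Y : Stack n d) : Stack n d := stack fun i => clip r (blk Y i)

theorem norm_clipStack_le {r : ℝ} (hr : 0 < r) (Y : Stack n d) : ‖clipStack r Y‖ ≤ ‖Y‖ := by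
  simpa using norm_le_of_blk_le (R := clipStack r Y) (S := Y) zero_le_one
    fun i => by simpa [clipStack] using norm_clip_le_norm hr (blk Y i)

theorem norm_clipStack_sub_le {r : ℝ} (hr : 0 < r) (Y Z : Stack n d) :
    ‖clipStack r Y - clipStack r Z‖ ≤ 2 * ‖Y - Z‖ :=
  norm_le_of_blk_le zero_le_two fun i => norm_clip_sub_clip_le hr (blk Y i) (blk Z i)

end Clip

/-! ### The clipped power iteration and its fixed points. -/

section FixedPoint

variable {n d : ℕ}

/-- For `R` with orthogonal blocks this is the symmetric part of `Gᵀ R`. -/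
noncomputable def gauge (G R : Stack n d) : Matrix (Fin d) (Fin d) ℝ :=
  (n : ℝ) • 1 - (1 / 2 : ℝ) • ((R - G)ᵀ * (R - G))

/-- The matrix whose blockwise polar factors define the clipped power iteration with noise `N`. -/
noncomputable def target (G : Stack n d) (N : BigMatrix n d) (R : Stack n d) : Stack n d :=
  G * gauge G R + clipStack ((n : ℝ) / 8) (N * R)

/-- The stacks with orthogonal blocks at distance at most `√n / 4` from `G`. -/
def nbhd (G : Stack n d) : Set (Stack n d) := {R | IsOrth (blk R) ∧ ‖R - G‖ ≤ √n / 4}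

/-- `R` is a fixed point of the clipped power iteration. -/
def IsClippedFix (G : Stack n d) (N : BigMatrix n d) (R : Stack n d) : Prop :=
  R ∈ nbhd G ∧ ∀ i, IsPolar (3 / 4 * (n : ℝ)) (blk (target G N R) i) (blk R i)

theorem gauge_transpose (G R : Stack n d) : (gauge G R)ᵀ = gauge G R := by
  simp [gauge, Matrix.transpose_sub, Matrix.transpose_mul]

theorem norm_gauge_sub_le (G R : Stack n d) :
    ‖gauge G R - (n : ℝ) • 1‖ ≤ 1 / 2 * ‖R - G‖ ^ 2 := by
  have e : gauge G R - (n : ℝ) • 1 = -((1 / 2 : ℝ) • ((R - G)ᵀ * (R - G))) := by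
    simp [gauge]
  rw [e, norm_neg, norm_smul, Real.norm_of_nonneg (by norm_num), sq]
  refine mul_le_mul_of_nonneg_left ((Matrix.frobenius_norm_mul _ _).trans ?_) (by norm_num)
  rw [Matrix.frobenius_norm_transpose]

/-- A difference of two squares, so the Lipschitz constant of the gauge shrinks with the distance to
`G`. The unsymmetrized `Gᵀ R` lacks this property, which is what makes the iteration contract. -/
theorem norm_gauge_sub_gauge_le (G R S : Stack n d) :
    ‖gauge G R - gauge G S‖ ≤ 1 / 2 * (‖R - G‖ + ‖S - G‖) * ‖R - S‖ := by
  have e : gauge G R - gauge G S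
      = -((1 / 2 : ℝ) • ((R - G)ᵀ * (R - S) + (R - S)ᵀ * (S - G))) := by
    have : (R - G)ᵀ * (R - S) + (R - S)ᵀ * (S - G)
        = (R - G)ᵀ * (R - G) - (S - G)ᵀ * (S - G) := by
      simp only [Matrix.transpose_sub, Matrix.sub_mul, Matrix.mul_sub]
      abel
    rw [this, gauge, gauge, smul_sub]
    abel
  rw [e, norm_neg, norm_smul, Real.norm_of_nonneg (by norm_num), mul_assoc]
  refine mul_le_mul_of_nonneg_left ((norm_add_le _ _).trans ?_) (by norm_num)
  have h1 := Matrix.frobenius_norm_mul (R - G)ᵀ (R - S)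
  have h2 := Matrix.frobenius_norm_mul (R - S)ᵀ (S - G)
  rw [Matrix.frobenius_norm_transpose] at h1 h2
  linarith

theorem sq_le_of_mem_nbhd {G R : Stack n d} (hR : R ∈ nbhd G) : ‖R - G‖ ^ 2 ≤ n / 16 := by
  have := pow_le_pow_left₀ (norm_nonneg _) hR.2 2
  rw [div_pow, Real.sq_sqrt (Nat.cast_nonneg n)] at this
  linarith

theorem blk_target (G : Stack n d) (N : BigMatrix n d) (R : Stack n d) (i : Fin n) :
    blk (target G N R) i = blk G i * gauge G R + clip ((n : ℝ) / 8) (blk (N * R) i) := rfl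

theorem norm_blk_target_sub_le {G R : Stack n d} (hG : IsOrth (blk G)) (N : BigMatrix n d)
    (i : Fin n) : ‖blk (target G N R) i - (n : ℝ) • blk G i‖
      ≤ 1 / 2 * ‖R - G‖ ^ 2 + ‖clip ((n : ℝ) / 8) (blk (N * R) i)‖ := by
  have e : blk (target G N R) i - (n : ℝ) • blk G i
      = blk G i * (gauge G R - (n : ℝ) • 1) + clip ((n : ℝ) / 8) (blk (N * R) i) := by
    rw [blk_target, Matrix.mul_sub, Matrix.mul_smul, Matrix.mul_one]; abel
  rw [e]
  refine (norm_add_le _ _).trans ?_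
  rw [frobenius_norm_orth_mul (orth_transpose_mul (hG i))]
  gcongr
  exact norm_gauge_sub_le G R

theorem exists_isPolar_target (hn : 0 < n) {G R : Stack n d} (hG : IsOrth (blk G))
    (hR : R ∈ nbhd G) (N : BigMatrix n d) (i : Fin n) :
    ∃ U, IsPolar (3 / 4 * (n : ℝ)) (blk (target G N R) i) U := by
  have hn' : (0 : ℝ) < n := by exact_mod_cast hn
  refine exists_isPolar_of_norm_sub_le hn' (hG i) ?_
  have h1 := norm_blk_target_sub_le (R := R) hG N i
  have h2 := norm_clip_le (show 0 < (n : ℝ) / 8 by positivity) (blk (N * R) i)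
  have h3 := sq_le_of_mem_nbhd hR
  linarith

theorem norm_sub_le_of_isPolar {ℓ : ℝ} (hℓ : 0 < ℓ) {Y Z R S : Stack n d}
    (hR : ∀ i, IsPolar ℓ (blk Y i) (blk R i)) (hS : ∀ i, IsPolar ℓ (blk Z i) (blk S i)) :
    ℓ * ‖R - S‖ ≤ ‖Y - Z‖ := by
  have : ‖R - S‖ ≤ ℓ⁻¹ * ‖Y - Z‖ := by
    refine norm_le_of_blk_le (by positivity) fun i => ?_
    rw [le_inv_mul_iff₀ hℓ]
    exact (hR i).norm_sub_le (hS i)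
  rwa [le_inv_mul_iff₀ hℓ] at this

/-- The gauge contributes `√n · √n/4 = n/4`, and the 2-Lipschitz clipping of the noise `2ν ≤ n/8`.
-/
theorem norm_target_sub_target_le (hn : 0 < n) {G R S : Stack n d} (hG : IsOrth (blk G))
    (hR : R ∈ nbhd G) (hS : S ∈ nbhd G) {N : BigMatrix n d} (hN : Nᵀ = N) {ν : ℝ} (hν : 0 ≤ ν)
    (hop : OpBound N ν) (hν' : ν ≤ n / 16) :
    ‖target G N R - target G N S‖ ≤ 3 / 8 * n * ‖R - S‖ := by
  have hn' : (0 : ℝ) < n := by exact_mod_cast hn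
  have e : target G N R - target G N S = G * (gauge G R - gauge G S)
      + (clipStack ((n : ℝ) / 8) (N * R) - clipStack ((n : ℝ) / 8) (N * S)) := by
    rw [target, target, Matrix.mul_sub]; abel
  have h1 := norm_gauge_sub_gauge_le G R S
  have h2 : ‖gauge G R - gauge G S‖ ≤ √n / 4 * ‖R - S‖ := by
    refine h1.trans (mul_le_mul_of_nonneg_right ?_ (norm_nonneg _))
    linarith [hR.2, hS.2]
  have h3 := norm_clipStack_sub_le (show 0 < (n : ℝ) / 8 by positivity) (N * R) (N * S)
  rw [← Matrix.mul_sub] at h3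
  have h4 := hop.norm_mul_le hN hν (R - S)
  have h5 : ν * ‖R - S‖ ≤ n / 16 * ‖R - S‖ := mul_le_mul_of_nonneg_right hν' (norm_nonneg _)
  have h6 : √n * ‖gauge G R - gauge G S‖ ≤ n / 4 * ‖R - S‖ := by
    refine (mul_le_mul_of_nonneg_left h2 (Real.sqrt_nonneg _)).trans (le_of_eq ?_)
    rw [← mul_assoc, mul_div_assoc', Real.mul_self_sqrt (Nat.cast_nonneg n)]
  rw [e]
  refine (norm_add_le _ _).trans ?_
  rw [hG.norm_mul]
  linarith

theorem norm_target_sub_le (hn : 0 < n) {G R : Stack n d} (hG : IsOrth (blk G))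
    (hR : R ∈ nbhd G) {N : BigMatrix n d} (hN : Nᵀ = N) {ν : ℝ} (hν : 0 ≤ ν)
    (hop : OpBound N ν) :
    ‖target G N R - (n : ℝ) • G‖ ≤ √n * (1 / 2 * ‖R - G‖ ^ 2) + √n * (ν * √d) := by
  have hn' : (0 : ℝ) < n := by exact_mod_cast hn
  have e : target G N R - (n : ℝ) • G = G * (gauge G R - (n : ℝ) • 1)
      + clipStack ((n : ℝ) / 8) (N * R) := by
    rw [target, Matrix.mul_sub, Matrix.mul_smul, Matrix.mul_one]; abel
  have h3 := norm_clipStack_le (show 0 < (n : ℝ) / 8 by positivity) (N * R)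
  have h4 := hop.norm_mul_le hN hν R
  rw [hR.1.norm_eq] at h4
  have h5 : √n * ‖gauge G R - (n : ℝ) • 1‖ ≤ √n * (1 / 2 * ‖R - G‖ ^ 2) :=
    mul_le_mul_of_nonneg_left (norm_gauge_sub_le G R) (Real.sqrt_nonneg _)
  rw [e]
  refine (norm_add_le _ _).trans ?_
  rw [hG.norm_mul]
  linarith

theorem isClosed_nbhd (G : Stack n d) : IsClosed (nbhd G) := by
  have h1 : IsClosed {R : Stack n d | ‖R - G‖ ≤ √n / 4} :=
    isClosed_le (by fun_prop) continuous_const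
  have h2 : IsClosed {R : Stack n d | IsOrth (blk R)} := by
    have : {R : Stack n d | IsOrth (blk R)} = ⋂ i, {R : Stack n d | blk R i * (blk R i)ᵀ = 1} := by
      ext R
      simp only [Set.mem_ofPred_eq, Set.mem_iInter]
      exact ⟨fun h i => orth_mul_transpose (h i),
        fun h i => mem_orthogonalGroup_of_mul_transpose (h i)⟩
    rw [this]
    refine isClosed_iInter fun i => isClosed_eq ?_ continuous_const
    have hb : Continuous fun R : Stack n d => blk R i := by
      unfold blk
      fun_prop
    fun_prop
  exact h2.inter h1

/-- Banach's fixed point theorem on `nbhd G`: the target is `(3/8)n`-Lipschitz and the polar factor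
`1/((3/4)n)`-Lipschitz, which gives the ratio `1/2`. -/
theorem exists_isClippedFix (hn : 0 < n) {G : Stack n d} (hG : IsOrth (blk G))
    {N : BigMatrix n d} (hN : Nᵀ = N) {ν : ℝ} (hν : 0 ≤ ν) (hop : OpBound N ν)
    (hν' : ν ≤ n / 16) (hνd : ν * √d ≤ n / 16) : ∃ R, IsClippedFix G N R := by
  classical
  have hn' : (0 : ℝ) < n := by exact_mod_cast hn
  -- The default `1` is never reached on `nbhd G`.
  let f : Stack n d → Stack n d := fun R => stack fun i =>
    if h : ∃ U, IsPolar (3 / 4 * (n : ℝ)) (blk (target G N R) i) U then h.choose else 1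
  have hf : ∀ R ∈ nbhd G, ∀ i, IsPolar (3 / 4 * (n : ℝ)) (blk (target G N R) i) (blk (f R) i) := by
    intro R hR i
    have h := exists_isPolar_target hn hG hR N i
    simp only [f, blk_stack, dif_pos h]
    exact h.choose_spec
  have hGmem : G ∈ nbhd G := ⟨hG, by rw [sub_self, norm_zero]; positivity⟩
  have hmaps : Set.MapsTo f (nbhd G) (nbhd G) := by
    intro R hR
    refine ⟨fun i => (hf R hR i).1, ?_⟩
    -- `G` itself is the polar factor of the noiseless target `n G`.
    have h1 := norm_sub_le_of_isPolar (show 0 < 3 / 4 * (n : ℝ) by positivity) (hf R hR)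
      (Z := (n : ℝ) • G) (S := G) fun i => isPolar_smul_self (by linarith) (hG i)
    have h2 := norm_target_sub_le hn hG hR hN hν hop
    have h3 : √n * (1 / 2 * ‖R - G‖ ^ 2) ≤ √n * (1 / 32 * n) :=
      mul_le_mul_of_nonneg_left (by linarith [sq_le_of_mem_nbhd hR]) (Real.sqrt_nonneg _)
    have h4 : √n * (ν * √d) ≤ √n * (n / 16) := mul_le_mul_of_nonneg_left hνd (Real.sqrt_nonneg _)
    have h5 : (n : ℝ) * ‖f R - G‖ ≤ n * (√n / 4) := by
      have : 0 ≤ √n * (n : ℝ) := by positivity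
      linarith
    exact le_of_mul_le_mul_left h5 hn'
  have hcontr : ContractingWith (1 / 2) (hmaps.restrict f (nbhd G) (nbhd G)) := by
    refine ⟨by rw [div_lt_one] <;> norm_num, LipschitzWith.of_dist_le_mul fun R S => ?_⟩
    rw [Subtype.dist_eq, Subtype.dist_eq, dist_eq_norm, dist_eq_norm]
    simp only [Set.MapsTo.val_restrict_apply]
    have h1 := norm_sub_le_of_isPolar (show 0 < 3 / 4 * (n : ℝ) by positivity)
      (hf R R.2) (hf S S.2)
    have h2 := norm_target_sub_target_le hn hG R.2 S.2 hN hν hop hν'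
    have h3 : (n : ℝ) * ‖f R - f S‖ ≤ n * (1 / 2 * ‖(R : Stack n d) - S‖) := by linarith
    have := le_of_mul_le_mul_left h3 hn'
    simpa using this
  obtain ⟨R, hR, hfix, -⟩ := hcontr.exists_fixedPoint' (isClosed_nbhd G).isComplete hmaps hGmem
    (edist_ne_top _ _)
  refine ⟨R, hR, fun i => ?_⟩
  have := hf R hR i
  rwa [hfix.eq] at this

/-- Stability of the contraction: `(3/4)n ‖R - S‖` is at most `(3/8)n ‖R - S‖` plus the change of
the target at `S`. It yields uniqueness, continuity in the noise and the leave-one-out comparison.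
-/
theorem IsClippedFix.norm_sub_le (hn : 0 < n) {G R S : Stack n d} (hG : IsOrth (blk G))
    {N N' : BigMatrix n d} (hR : IsClippedFix G N R) (hS : IsClippedFix G N' S) (hN : Nᵀ = N)
    {ν : ℝ} (hν : 0 ≤ ν) (hop : OpBound N ν) (hν' : ν ≤ n / 16) :
    3 / 8 * n * ‖R - S‖ ≤ 2 * ‖(N - N') * S‖ := by
  have hn' : (0 : ℝ) < n := by exact_mod_cast hn
  have h1 := norm_sub_le_of_isPolar (show 0 < 3 / 4 * (n : ℝ) by positivity) hR.2 hS.2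
  have h2 := norm_target_sub_target_le hn hG hR.1 hS.1 hN hν hop hν'
  have h3 : ‖target G N S - target G N' S‖ ≤ 2 * ‖(N - N') * S‖ := by
    rw [target, target, add_sub_add_left_eq_sub, Matrix.sub_mul]
    exact norm_clipStack_sub_le (show 0 < (n : ℝ) / 8 by positivity) _ _
  have h4 := norm_sub_le_norm_sub_add_norm_sub (target G N R) (target G N S) (target G N' S)
  linarith

/-- The error of a clipped fixed point in Frobenius norm. -/
theorem IsClippedFix.norm_sub_signal_le (hn : 0 < n) {G R : Stack n d} (hG : IsOrth (blk G))
    {N : BigMatrix n d} (hR : IsClippedFix G N R) (hN : Nᵀ = N) {ν η : ℝ} (hν : 0 ≤ ν)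
    (hop : OpBound N ν) (hη : ν * √d ≤ η * n) : ‖R - G‖ ≤ 8 / 5 * η * √n := by
  have hn' : (0 : ℝ) < n := by exact_mod_cast hn
  have h1 := norm_sub_le_of_isPolar (show 0 < 3 / 4 * (n : ℝ) by positivity) hR.2
      (Z := (n : ℝ) • G) (S := G) fun i => isPolar_smul_self (by linarith) (hG i)
  have h2 := norm_target_sub_le hn hG hR.1 hN hν hop
  have h3 : √n * (1 / 2 * ‖R - G‖ ^ 2) ≤ n / 8 * ‖R - G‖ := by
    have h := mul_le_mul_of_nonneg_left hR.1.2
      (show 0 ≤ √n * (1 / 2 * ‖R - G‖) by positivity)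
    have e : √n * (1 / 2 * ‖R - G‖) * (√n / 4) = (√n * √n) / 8 * ‖R - G‖ := by ring
    rw [e, Real.mul_self_sqrt hn'.le] at h
    linarith [sq ‖R - G‖]
  have h4 : √n * (ν * √d) ≤ √n * (η * n) := mul_le_mul_of_nonneg_left hη (Real.sqrt_nonneg _)
  have h5 : (n : ℝ) * ‖R - G‖ ≤ n * (8 / 5 * η * √n) := by linarith
  exact le_of_mul_le_mul_left h5 hn'

end FixedPoint

/-! ### Dual certificates for the semidefinite relaxation. -/

section Certificate

variable {n d : ℕ}

/-- The block diagonal matrix with blocks `Λ i`. -/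
def blockDiag (Λ : Fin n → Matrix (Fin d) (Fin d) ℝ) : BigMatrix n d :=
  Matrix.of fun p q => if p.1 = q.1 then Λ p.1 p.2 q.2 else 0

theorem blockDiag_transpose {Λ : Fin n → Matrix (Fin d) (Fin d) ℝ} (h : ∀ i, (Λ i)ᵀ = Λ i) :
    (blockDiag Λ)ᵀ = blockDiag Λ := by
  ext ⟨i, a⟩ ⟨j, b⟩
  by_cases hij : i = j
  · subst hij
    simpa [blockDiag] using congrFun (congrFun (h i) a) b
  · simp [blockDiag, hij, Ne.symm hij]

theorem blk_blockDiag_mul (Λ : Fin n → Matrix (Fin d) (Fin d) ℝ) (R : Stack n d) (i : Fin n) :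
    blk (blockDiag Λ * R) i = Λ i * blk R i := by
  ext a b
  simp [blk, blockDiag, Matrix.mul_apply, Fintype.sum_prod_type, ite_mul, Finset.sum_ite_irrel]

theorem trace_blockDiag_mul (Λ : Fin n → Matrix (Fin d) (Fin d) ℝ) (Y : BigMatrix n d) :
    (blockDiag Λ * Y).trace = ∑ i, (Λ i * block Y i i).trace := by
  simp [block, blockDiag, Matrix.trace, Matrix.mul_apply, Fintype.sum_prod_type, ite_mul,
    Finset.sum_ite_irrel]

theorem dotProduct_blockDiag_mulVec (Λ : Fin n → Matrix (Fin d) (Fin d) ℝ)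
    (u : Fin n × Fin d → ℝ) :
    u ⬝ᵥ (blockDiag Λ *ᵥ u) = ∑ i, (fun a => u (i, a)) ⬝ᵥ (Λ i *ᵥ fun a => u (i, a)) := by
  simp [blockDiag, dotProduct, Matrix.mulVec, Fintype.sum_prod_type, ite_mul,
    Finset.sum_ite_irrel]

theorem block_gram (R : Fin n → Matrix (Fin d) (Fin d) ℝ) (i j : Fin n) :
    block (gram R) i j = R i * (R j)ᵀ := rfl

theorem isFeasible_gram {R : Fin n → Matrix (Fin d) (Fin d) ℝ} (hR : IsOrth R) :
    IsFeasible (gram R) := by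
  refine ⟨?_, fun i => orth_mul_transpose (hR i)⟩
  rw [gram_eq]
  simpa [Matrix.conjTranspose_eq_transpose_of_trivial] using
    Matrix.posSemidef_self_mul_conjTranspose (stack R)

theorem matInner_eq_sum_block (X Y : BigMatrix n d) :
    matInner X Y = ∑ i, ∑ j, matInner (block X i j) (block Y i j) := by
  simp only [matInner, trace_transpose_mul_eq_sum, Fintype.sum_prod_type, block, Matrix.of_apply]
  refine Finset.sum_congr rfl fun i _ => ?_
  rw [Finset.sum_comm]

theorem matInner_comm {m : Type*} [Fintype m] (X Y : Matrix m m ℝ) :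
    matInner X Y = matInner Y X := by
  simp only [matInner, trace_transpose_mul_eq_sum, mul_comm]

theorem sum_sum_eq_of_symm (g : Fin n → Fin n → ℝ) (hg : ∀ i j, g i j = g j i) :
    ∑ i, ∑ j, g i j = 2 * (∑ i, ∑ j ∈ Finset.Ioi i, g i j) + ∑ i, g i i := by
  have h1 : ∀ i, ∑ j, g i j
      = ∑ j ∈ Finset.Ioi i, g i j + ∑ j ∈ Finset.Iio i, g i j + g i i := by
    intro i
    have : (Finset.univ : Finset (Fin n)) = (Finset.Ioi i ∪ Finset.Iio i) ∪ {i} := by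
      ext j
      simp only [Finset.mem_univ, Finset.mem_union, Finset.mem_Ioi, Finset.mem_Iio,
        Finset.mem_singleton, true_iff]
      omega
    rw [this, Finset.sum_union, Finset.sum_union, Finset.sum_singleton]
    · rw [Finset.disjoint_left]
      intro j; simp only [Finset.mem_Ioi, Finset.mem_Iio]; omega
    · simp
  have h2 : ∑ i, ∑ j ∈ Finset.Iio i, g i j = ∑ i, ∑ j ∈ Finset.Ioi i, g i j := by
    rw [Finset.sum_comm' (s' := fun j => Finset.Ioi j) (t' := Finset.univ) (by simp)]
    exact Finset.sum_congr rfl fun i _ => Finset.sum_congr rfl fun j _ => hg _ _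
  simp only [h1, Finset.sum_add_distrib, h2]
  ring

/-- By symmetry each pair `i < j` counts twice, and the diagonal blocks `R_i R_iᵀ = I` contribute a
constant. Hence the MLE problem is the relaxation restricted to Gram matrices. -/
theorem matInner_gram_eq {A : BigMatrix n d} (hA : Aᵀ = A)
    {R : Fin n → Matrix (Fin d) (Fin d) ℝ} (hR : IsOrth R) :
    matInner A (gram R) = 2 * mleObjective A R + ∑ i, (block A i i).trace := by
  rw [matInner_comm, matInner_eq_sum_block, sum_sum_eq_of_symm]
  · congr 1
    refine Finset.sum_congr rfl fun i _ => ?_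
    rw [block_gram, orth_mul_transpose (hR i), matInner, Matrix.transpose_one, Matrix.one_mul]
  · intro i j
    have h1 : block A j i = (block A i j)ᵀ := by
      ext a b
      exact congrFun (congrFun hA.symm (j, a)) (i, b)
    have h2 : block (gram R) j i = (block (gram R) i j)ᵀ := by
      simp [block_gram, Matrix.transpose_mul]
    rw [h1, h2, matInner, matInner, Matrix.transpose_transpose, ← Matrix.trace_transpose,
      Matrix.transpose_mul, Matrix.transpose_transpose, Matrix.trace_mul_comm]

open scoped MatrixOrder in
theorem exists_eq_transpose_mul_self {m : Type*} [Fintype m] {Y : Matrix m m ℝ}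
    (hY : Y.PosSemidef) : ∃ B : Matrix m m ℝ, Y = Bᵀ * B := by
  classical
  obtain ⟨B, hB⟩ := CStarAlgebra.nonneg_iff_eq_star_mul_self.mp hY.nonneg
  exact ⟨B, by
    rwa [Matrix.star_eq_conjTranspose, Matrix.conjTranspose_eq_transpose_of_trivial] at hB⟩

theorem trace_mul_nonneg {m : Type*} [Fintype m] {K Y : Matrix m m ℝ} (hK : K.PosSemidef)
    (hY : Y.PosSemidef) : 0 ≤ (K * Y).trace := by
  obtain ⟨B, hB⟩ := exists_eq_transpose_mul_self hY
  have := trace_conj_nonneg hK Bᵀ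
  rwa [Matrix.transpose_transpose, Matrix.mul_assoc, Matrix.trace_mul_comm, Matrix.mul_assoc,
    ← hB] at this

/-- A dual certificate makes the semidefinite relaxation tight. -/
theorem isTight_of_certificate (hn : 0 < n) {A M : BigMatrix n d} (hA : Aᵀ = A) (hM : Mᵀ = M)
    {R : Stack n d} (hR : IsOrth (blk R)) {Λ : Fin n → Matrix (Fin d) (Fin d) ℝ}
    (hAM : A = blockDiag Λ - M) (hMR : M * R = 0) {c : ℝ} (hc : 0 < c)
    (hpos : ∀ u, Rᵀ *ᵥ u = 0 → c * (u ⬝ᵥ u) ≤ u ⬝ᵥ (M *ᵥ u)) :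
    IsTight A ∧ ∀ R', IsMLE A R' →
      ∃ Q ∈ Matrix.orthogonalGroup (Fin d) ℝ, ∀ i, R' i = blk R i * Q := by
  have hn' : (n : ℝ) ≠ 0 := by exact_mod_cast hn.ne'
  set P : BigMatrix n d := 1 - (n : ℝ)⁻¹ • (R * Rᵀ) with hP
  have hRR := hR.transpose_mul_self
  have hPt : Pᵀ = P := by simp [hP, Matrix.transpose_sub, Matrix.transpose_mul]
  have hRP : Rᵀ * P = 0 := by
    rw [hP, Matrix.mul_sub, Matrix.mul_smul, ← Matrix.mul_assoc, hRR]
    simp [smul_smul, hn']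
  have hPP : P * P = P := by
    nth_rw 1 [hP]
    rw [Matrix.sub_mul, Matrix.smul_mul, Matrix.mul_assoc, hRP, Matrix.mul_zero, smul_zero,
      sub_zero, Matrix.one_mul]
  have hMP : M * P = M := by
    rw [hP, Matrix.mul_sub, Matrix.mul_smul, ← Matrix.mul_assoc, hMR]
    simp
  have hPM : P * M = M := by
    rw [← hM, ← hPt, ← Matrix.transpose_mul, hMP]
  -- `P` projects onto the complement of the columns of `R`, and `M = P M P`, so positivity there is
  -- `M ⪰ c P` everywhere.
  have hK : (M - c • P).PosSemidef := by
    rw [posSemidef_real_iff]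
    refine ⟨by simp [Matrix.transpose_sub, hM, hPt], fun u => ?_⟩
    have h1 := hpos (P *ᵥ u) (by rw [Matrix.mulVec_mulVec, hRP, Matrix.zero_mulVec])
    have h2 : ∀ v, (P *ᵥ u) ⬝ᵥ v = u ⬝ᵥ (P *ᵥ v) := by
      intro v
      rw [Matrix.dotProduct_mulVec, ← Matrix.mulVec_transpose, hPt]
    rw [h2, h2, Matrix.mulVec_mulVec, Matrix.mulVec_mulVec, Matrix.mulVec_mulVec, hPP,
      Matrix.mul_assoc, hMP, hPM] at h1
    rw [Matrix.sub_mulVec, Matrix.smul_mulVec, dotProduct_sub, dotProduct_smul, smul_eq_mul]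
    linarith
  set τ : ℝ := ∑ i, (Λ i).trace with hτ
  have hfeas : ∀ Y, IsFeasible Y → matInner A Y = τ - (M * Y).trace := by
    intro Y hY
    rw [matInner, hA, hAM, Matrix.sub_mul, Matrix.trace_sub, trace_blockDiag_mul]
    simp [hY.2, hτ]
  have hX : IsFeasible (gram (blk R)) := isFeasible_gram hR
  have hXval : matInner A (gram (blk R)) = τ := by
    rw [hfeas _ hX, gram_eq, stack_blk, ← Matrix.mul_assoc, hMR]
    simp
  have hle : ∀ Y, IsFeasible Y → c * (P * Y).trace ≤ (M * Y).trace ∧ 0 ≤ (P * Y).trace ∧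
      ((P * Y).trace = 0 → P * Y = 0) := by
    intro Y hY
    have h1 := trace_mul_nonneg hK hY.1
    rw [Matrix.sub_mul, Matrix.smul_mul, Matrix.trace_sub, Matrix.trace_smul, smul_eq_mul] at h1
    obtain ⟨B, hB⟩ := exists_eq_transpose_mul_self hY.1
    have h2 : (P * Y).trace = ‖B * P‖ ^ 2 := by
      rw [frobenius_norm_sq_eq_trace, Matrix.transpose_mul, hPt, Matrix.trace_mul_comm (P * Bᵀ),
        Matrix.mul_assoc, ← Matrix.mul_assoc P, hPP, Matrix.trace_mul_comm B, Matrix.mul_assoc, ← hB]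
    refine ⟨by linarith, by rw [h2]; positivity, fun h => ?_⟩
    rw [h2] at h
    have h3 : B * P = 0 := by simpa using h
    have h4 : P * Bᵀ = 0 := by rw [← hPt, ← Matrix.transpose_mul, h3, Matrix.transpose_zero]
    rw [hB, ← Matrix.mul_assoc, h4, Matrix.zero_mul]
  have huniq : ∀ Y, IsFeasible Y → τ ≤ matInner A Y → Y = gram (blk R) := by
    intro Y hY hτY
    obtain ⟨h1, h2, h3⟩ := hle Y hY
    rw [hfeas Y hY] at hτY
    -- Optimality of `Y` gives `tr (M Y) ≤ 0`, hence `tr (P Y) = 0`. So `Y` lives on the columns of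
    -- `R` and has the form `R C Rᵀ`; one diagonal block then determines `C`.
    have hPY : P * Y = 0 := h3 (by nlinarith)
    have hYt : Yᵀ = Y := (posSemidef_real_iff.1 hY.1).1
    have hY1 : Y = (n : ℝ)⁻¹ • (R * (Rᵀ * Y)) := by
      rw [hP, Matrix.sub_mul, Matrix.one_mul, sub_eq_zero, Matrix.smul_mul, Matrix.mul_assoc] at hPY
      exact hPY
    have hY2 : Y = (n : ℝ)⁻¹ • (Y * R * Rᵀ) := by
      conv_lhs => rw [← hYt, hY1]
      simp [Matrix.transpose_mul, hYt, Matrix.mul_assoc]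
    obtain ⟨C, hC⟩ : ∃ C : Matrix (Fin d) (Fin d) ℝ, Y = R * C * Rᵀ := by
      refine ⟨(n : ℝ)⁻¹ • (n : ℝ)⁻¹ • (Rᵀ * Y * R), ?_⟩
      conv_lhs => rw [hY1, hY2]
      simp [Matrix.mul_assoc]
    have hC1 : C = 1 := by
      have h4 := hY.2 ⟨0, hn⟩
      have h5 : block Y ⟨0, hn⟩ ⟨0, hn⟩ = blk R ⟨0, hn⟩ * C * (blk R ⟨0, hn⟩)ᵀ := by
        rw [hC]; rfl
      rw [h5] at h4
      have ho := orth_transpose_mul (hR ⟨0, hn⟩)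
      calc C = (blk R ⟨0, hn⟩)ᵀ * blk R ⟨0, hn⟩ * C * ((blk R ⟨0, hn⟩)ᵀ * blk R ⟨0, hn⟩) := by
            rw [ho]; simp
        _ = (blk R ⟨0, hn⟩)ᵀ * (blk R ⟨0, hn⟩ * C * (blk R ⟨0, hn⟩)ᵀ) * blk R ⟨0, hn⟩ := by
            simp only [Matrix.mul_assoc]
        _ = 1 := by rw [h4, Matrix.mul_one, ho]
    rw [hC, hC1, Matrix.mul_one, gram_eq, stack_blk]
  have hmax : ∀ Y, IsFeasible Y → matInner A Y ≤ τ := by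
    intro Y hY
    obtain ⟨h1, h2, -⟩ := hle Y hY
    rw [hfeas Y hY]
    nlinarith
  have hRmle : IsMLE A (blk R) := by
    refine ⟨hR, fun R' hR' => ?_⟩
    have h1 := hmax _ (isFeasible_gram hR')
    rw [← hXval, matInner_gram_eq hA hR', matInner_gram_eq hA hR] at h1
    linarith
  have hmle : ∀ R', IsMLE A R' ↔ IsOrth R' ∧ gram R' = gram (blk R) := by
    intro R'
    constructor
    · rintro ⟨hR', hopt⟩
      refine ⟨hR', huniq _ (isFeasible_gram hR') ?_⟩
      have := hopt _ hR
      rw [← hXval, matInner_gram_eq hA hR', matInner_gram_eq hA hR]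
      linarith
    · rintro ⟨hR', hgram⟩
      have h1 := matInner_gram_eq hA hR'
      rw [hgram, matInner_gram_eq hA hR] at h1
      refine ⟨hR', fun R'' hR'' => (hRmle.2 R'' hR'').trans (by linarith)⟩
  refine ⟨⟨gram (blk R), ⟨hX, fun Y hY => (hmax Y hY).trans hXval.ge⟩, fun Y hY => ?_, ?_,
    ⟨blk R, hRmle⟩, hmle⟩, fun R' hR' => ?_⟩
  · exact huniq Y hY.1 (hXval.ge.trans (hY.2 _ hX))
  · rw [gram_eq, stack_blk, Matrix.rank_self_mul_transpose, ← Matrix.rank_transpose_mul_self, hRR,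
      Matrix.rank_of_isUnit]
    · simp
    · rw [Matrix.isUnit_iff_isUnit_det, Matrix.det_smul, Matrix.det_one, mul_one]
      exact (pow_ne_zero _ hn').isUnit
  · obtain ⟨ho, hg⟩ := (hmle R').1 hR'
    refine ⟨(blk R ⟨0, hn⟩)ᵀ * R' ⟨0, hn⟩, ?_, fun i => ?_⟩
    · apply mem_orthogonalGroup_of_mul_transpose
      rw [Matrix.transpose_mul, Matrix.transpose_transpose, Matrix.mul_assoc,
        ← Matrix.mul_assoc (R' _), orth_mul_transpose (ho _), Matrix.one_mul,
        orth_transpose_mul (hR _)]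
    · have h1 : R' i * (R' ⟨0, hn⟩)ᵀ = blk R i * (blk R ⟨0, hn⟩)ᵀ := by
        rw [← block_gram, ← block_gram, hg]
      rw [← Matrix.mul_assoc, ← h1, Matrix.mul_assoc, orth_transpose_mul (ho _), Matrix.mul_one]

/-- A clipped fixed point at which the clipping is inactive solves the relaxation. -/
theorem IsClippedFix.isTight_and_error (hn : 0 < n) {G R : Stack n d} (hd : 0 < d)
    (hG : IsOrth (blk G)) {N : BigMatrix n d} (hR : IsClippedFix G N R) (hN : Nᵀ = N) {ν η : ℝ}
    (hν : 0 ≤ ν) (hop : OpBound N ν) (hη : ν * √d ≤ η * n) (hη' : η ≤ 1 / 16)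
    (hrow : ∀ i, ‖blk (N * R) i‖ ≤ 2 * η * n) :
    IsTight (gram (blk G) + N) ∧
      ∀ R', IsMLE (gram (blk G) + N) R' → BlockErrorLE R' (blk G) (3 * η) := by
  have hn' : (0 : ℝ) < n := by exact_mod_cast hn
  have hη0 : 0 ≤ η := by
    by_contra! h
    have : 0 ≤ ν * √d := by positivity
    nlinarith
  have hν16 : ν ≤ n / 16 := by
    have h1 : 1 ≤ √(d : ℝ) := by rw [Real.one_le_sqrt]; exact_mod_cast hd
    nlinarith
  have hclip : ∀ i, clip ((n : ℝ) / 8) (blk (N * R) i) = blk (N * R) i := fun i =>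
    clip_of_norm_le (by positivity) ((hrow i).trans (by nlinarith))
  set T := gauge G R with hT
  have htarget : target G N R = G * T + N * R := by
    rw [target, clipStack]
    simp only [hclip, stack_blk, ← hT]
  set Y := target G N R with hY
  set Λ : Fin n → Matrix (Fin d) (Fin d) ℝ := fun i => blk Y i * (blk R i)ᵀ with hΛ
  have hΛt : ∀ i, (Λ i)ᵀ = Λ i := fun i => (hR.2 i).symm
  have hYΛ : ∀ i, blk Y i = Λ i * blk R i := fun i => by
    rw [hΛ, Matrix.mul_assoc, orth_transpose_mul (hR.1.1 i), Matrix.mul_one]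
  have hYD : Y = blockDiag Λ * R := by
    have : blk Y = blk (blockDiag Λ * R) := by
      funext i; rw [hYΛ, blk_blockDiag_mul]
    rw [← stack_blk Y, this, stack_blk]
  have hDt := blockDiag_transpose hΛt
  set Z := Gᵀ * R with hZ
  have hTZ : T = (1 / 2 : ℝ) • (Z + Zᵀ) := by
    rw [hT, gauge, Matrix.transpose_sub, Matrix.sub_mul, Matrix.mul_sub, Matrix.mul_sub,
      hG.transpose_mul_self, hR.1.1.transpose_mul_self, hZ, Matrix.transpose_mul,
      Matrix.transpose_transpose]
    module
  have hTt : Tᵀ = T := gauge_transpose G R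
  -- `Rᵀ Y = Rᵀ Λ R` and `Rᵀ N R` are symmetric, hence so is their difference `Zᵀ T`.
  have hcomm : Zᵀ * T = T * Z := by
    have h1 : (Rᵀ * Y)ᵀ = Rᵀ * Y := by
      rw [hYD, Matrix.transpose_mul, Matrix.transpose_mul, hDt, Matrix.transpose_transpose,
        Matrix.mul_assoc]
    have h2 : (Rᵀ * (N * R))ᵀ = Rᵀ * (N * R) := by
      rw [Matrix.transpose_mul, Matrix.transpose_mul, hN, Matrix.transpose_transpose,
        Matrix.mul_assoc]
    rw [htarget, Matrix.mul_add, Matrix.transpose_add, h2, add_left_inj, ← Matrix.mul_assoc,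
      Matrix.transpose_mul, hTt, Matrix.transpose_mul, Matrix.transpose_transpose] at h1
    rw [hZ, Matrix.transpose_mul, Matrix.transpose_transpose, h1]
  -- The antisymmetric part `K` of `Z` satisfies `K T + T K = 0`; since `T` is within `n/32` of `n
  -- I`, this forces `K = 0`.
  have hZT : Z = T := by
    set K := (1 / 2 : ℝ) • (Z - Zᵀ) with hK
    have hZK : Z = T + K := by rw [hTZ, hK]; module
    have hZtK : Zᵀ = T - K := by rw [hTZ, hK]; module
    set E := T - (n : ℝ) • 1 with hE
    have hTE : T = (n : ℝ) • 1 + E := by rw [hE]; abel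
    have hEn : ‖E‖ ≤ n / 32 := (norm_gauge_sub_le G R).trans (by
      linarith [sq_le_of_mem_nbhd hR.1])
    have h1 : (2 * n : ℝ) • K = -(K * E + E * K) := by
      rw [hZtK, hZK, Matrix.sub_mul, Matrix.mul_add] at hcomm
      have h2 : K * T + T * K = 0 := by
        have h3 : T * T - K * T - (T * T + T * K) = 0 := sub_eq_zero.2 hcomm
        rw [← neg_eq_zero, ← h3]; abel
      rw [hTE, Matrix.mul_add, Matrix.add_mul, Matrix.mul_smul K, Matrix.smul_mul _ _ K,
        Matrix.mul_one, Matrix.one_mul] at h2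
      rw [eq_neg_iff_add_eq_zero, ← h2]
      module
    have h2 : 2 * n * ‖K‖ ≤ 2 * (‖E‖ * ‖K‖) := by
      have h3 := congrArg norm h1
      rw [norm_smul, norm_neg, Real.norm_of_nonneg (by positivity)] at h3
      rw [h3]
      refine (norm_add_le _ _).trans ?_
      linarith [Matrix.frobenius_norm_mul K E, Matrix.frobenius_norm_mul E K]
    have h3 : ‖K‖ = 0 := by
      by_contra hne
      have : 0 < ‖K‖ := lt_of_le_of_ne (norm_nonneg _) (Ne.symm hne)
      nlinarith
    rw [hZK, norm_eq_zero.1 h3, add_zero]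
  set A := gram (blk G) + N with hA
  have hgram : gram (blk G) = G * Gᵀ := by rw [gram_eq, stack_blk]
  have hAt : Aᵀ = A := by
    rw [hA, Matrix.transpose_add, hN, hgram, Matrix.transpose_mul, Matrix.transpose_transpose]
  have hAR : A * R = Y := by
    rw [hA, Matrix.add_mul, hgram, Matrix.mul_assoc, ← hZ, hZT, htarget]
  -- On the complement of the columns of `R` the certificate is at least `3n/4 - n/16 - n/16`, from
  -- `Λ`, the signal and the noise; this exceeds `n/2`.
  have hcert := isTight_of_certificate hn (A := A) (M := blockDiag Λ - A) hAt
    (by rw [Matrix.transpose_sub, hDt, hAt]) hR.1.1 (Λ := Λ) (by abel)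
    (by rw [Matrix.sub_mul, hAR, ← hYD, sub_self]) (c := (n : ℝ) / 2) (by positivity) (by
      intro u hu
      have huu : u ⬝ᵥ u = ∑ i, (fun a => u (i, a)) ⬝ᵥ (fun a => u (i, a)) := by
        simp [dotProduct, Fintype.sum_prod_type]
      have h0 : 0 ≤ u ⬝ᵥ u := by simp only [dotProduct, ← sq]; positivity
      have h1 : 3 / 4 * n * (u ⬝ᵥ u) ≤ u ⬝ᵥ (blockDiag Λ *ᵥ u) := by
        rw [dotProduct_blockDiag_mulVec, huu, Finset.mul_sum]
        refine Finset.sum_le_sum fun i _ => ?_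
        have := (posSemidef_real_iff.1 (hR.2 i).2).2 (fun a => u (i, a))
        rw [Matrix.sub_mulVec, Matrix.smul_mulVec, Matrix.one_mulVec, dotProduct_sub,
          dotProduct_smul, smul_eq_mul] at this
        exact sub_nonneg.1 this
      have h2 : u ⬝ᵥ (gram (blk G) *ᵥ u) ≤ n / 16 * (u ⬝ᵥ u) := by
        -- Since `Rᵀ u = 0`, the signal sees `u` only through `R - G`.
        have e1 : Gᵀ *ᵥ u = -((R - G)ᵀ *ᵥ u) := by
          rw [Matrix.transpose_sub, Matrix.sub_mulVec, hu, zero_sub, neg_neg]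
        rw [hgram, ← Matrix.mulVec_mulVec, Matrix.dotProduct_mulVec, ← Matrix.mulVec_transpose, e1,
          neg_dotProduct_neg]
        refine (dotProduct_mulVec_le _ _).trans ?_
        rw [Matrix.frobenius_norm_transpose]
        exact mul_le_mul_of_nonneg_right (sq_le_of_mem_nbhd hR.1) h0
      have h3 := (abs_le.1 (hop u)).2
      have h4 : ν * (u ⬝ᵥ u) ≤ n / 16 * (u ⬝ᵥ u) := mul_le_mul_of_nonneg_right hν16 h0
      rw [Matrix.sub_mulVec, hA, Matrix.add_mulVec, dotProduct_sub, dotProduct_add]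
      have : 0 ≤ n * (u ⬝ᵥ u) := by positivity
      linarith)
  refine ⟨hcert.1, fun R' hR' => ?_⟩
  obtain ⟨Q, hQ, hRQ⟩ := hcert.2 R' hR'
  refine ⟨Q, hQ, fun i => ?_⟩
  rw [hRQ, ← Matrix.sub_mul, frobenius_norm_mul_orth (orth_mul_transpose hQ)]
  have h1 := (hR.2 i).norm_sub_le
    (isPolar_smul_self (c := (n : ℝ)) (by linarith) (hG i))
  have h2 := norm_blk_target_sub_le (R := R) hG N i
  have h3 := hR.norm_sub_signal_le hn hG hN hν hop hη
  rw [hclip] at h2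
  have h4 : ‖R - G‖ ^ 2 ≤ (8 / 5 * η) ^ 2 * n := by
    refine (pow_le_pow_left₀ (norm_nonneg _) h3 2).trans (le_of_eq ?_)
    rw [mul_pow, Real.sq_sqrt hn'.le]
  have h5 : (8 / 5 * η) ^ 2 * n ≤ 4 / 25 * (η * n) := by
    have : 0 ≤ η * n := by positivity
    nlinarith
  -- `(3/4)n ‖R_i - G_i‖` is at most `(2/25) η n` from the gauge plus `2 η n` from the noise row.
  have h6 : (n : ℝ) * ‖blk R i - blk G i‖ ≤ n * (3 * η) := by
    have := hrow i
    have : 0 ≤ η * n := by positivity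
    linarith
  exact le_of_mul_le_mul_left h6 hn'

/-! ### Leave-one-out comparison of fixed points. -/

/-- Zero out the `i`-th block row and column. -/
def leaveOut (i : Fin n) (N : BigMatrix n d) : BigMatrix n d :=
  Matrix.of fun p q => if p.1 = i ∨ q.1 = i then 0 else N p q

theorem OpBound.leaveOut {N : BigMatrix n d} {ν : ℝ} (hν : 0 ≤ ν) (h : OpBound N ν) (i : Fin n) :
    OpBound (leaveOut i N) ν := by
  intro x
  set y : Fin n × Fin d → ℝ := fun p => if p.1 = i then 0 else x p with hy
  have e : x ⬝ᵥ (OrthSync.leaveOut i N *ᵥ x) = y ⬝ᵥ (N *ᵥ y) := by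
    simp only [dotProduct, Matrix.mulVec, OrthSync.leaveOut, Matrix.of_apply, hy, Finset.mul_sum]
    refine Finset.sum_congr rfl fun p _ => Finset.sum_congr rfl fun q _ => ?_
    by_cases hp : p.1 = i <;> by_cases hq : q.1 = i <;> simp [hp, hq]
  rw [e]
  refine (h y).trans (mul_le_mul_of_nonneg_left ?_ hν)
  simp only [dotProduct, hy]
  refine Finset.sum_le_sum fun p _ => ?_
  split_ifs
  · simpa using mul_self_nonneg (x p)
  · rfl

/-- The leave-one-out comparison: rows of the noise that are small on the leave-one-out fixed
points are small on the fixed point. -/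
theorem IsClippedFix.norm_blk_mul_le (hn : 0 < n) {G R : Stack n d} (hd : 0 < d)
    (hG : IsOrth (blk G)) {N : BigMatrix n d} (hR : IsClippedFix G N R) (hN : Nᵀ = N) {ν η : ℝ}
    (hν : 0 ≤ ν) (hop : OpBound N ν) (hη : ν * √d ≤ η * n) (hη' : η ≤ 1 / 16) {i : Fin n}
    {S : Stack n d} (hS : IsClippedFix G (leaveOut i N) S) (hrow : ‖blk (N * S) i‖ ≤ η * n) :
    ‖blk (N * R) i‖ ≤ 2 * η * n := by
  have hn' : (0 : ℝ) < n := by exact_mod_cast hn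
  have hηn : 0 ≤ η * n := (by positivity : 0 ≤ ν * √d).trans hη
  have hν16 : ν ≤ n / 16 := by
    have h1 : 1 ≤ √(d : ℝ) := by rw [Real.one_le_sqrt]; exact_mod_cast hd
    nlinarith
  set Si : Stack n d := stack fun j => if j = i then blk S j else 0 with hSi
  have hSin : ‖Si‖ = √d := by
    rw [← sq_eq_sq₀ (norm_nonneg _) (Real.sqrt_nonneg _), norm_sq_eq_sum_blk,
      Real.sq_sqrt (Nat.cast_nonneg d), Finset.sum_eq_single i]
    · simpa [hSi] using hS.1.1.norm_blk_sq i
    · intro j _ hj; simp [hSi, hj]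
    · simp
  set Ri : Stack n d := stack fun j => if j = i then blk (N * S) j else 0 with hRi
  have hRin : ‖Ri‖ = ‖blk (N * S) i‖ := by
    rw [← sq_eq_sq₀ (norm_nonneg _) (norm_nonneg _), norm_sq_eq_sum_blk, Finset.sum_eq_single i]
    · simp [hRi]
    · intro j _ hj; simp [hRi, hj]
    · simp
  -- `N - leaveOut i N` is a cross. Applied to `S`, its row gives `(N S)_i`, of norm at most `η n`,
  -- and its column gives blocks of `N Si`, of norm at most `ν √d`.
  have hdiff : ‖(N - leaveOut i N) * S‖ ≤ 2 * (η * n) := by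
    have h1 : ‖(N - leaveOut i N) * S‖ ≤ 1 * ‖Ri‖ + 1 * ‖N * Si‖ := by
      have hblk : ∀ j, blk ((N - leaveOut i N) * S) j
          = if j = i then blk (N * S) j else blk (N * Si) j := by
        intro j
        by_cases hj : j = i
        · rw [if_pos hj]
          ext a b
          simp [blk, Matrix.mul_apply, leaveOut, hj]
        · rw [if_neg hj]
          ext a b
          simp only [blk, Matrix.mul_apply, leaveOut, hj, hSi, stack, Matrix.of_apply, false_or,
            Matrix.sub_apply]
          refine Finset.sum_congr rfl fun q _ => ?_
          obtain ⟨q, c⟩ := q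
          by_cases hq : q = i <;> simp [hq]
      set Qi : Stack n d := stack fun j => if j = i then 0 else blk (N * Si) j with hQi
      have hsplit : (N - leaveOut i N) * S = Ri + Qi := by
        rw [← stack_blk ((N - leaveOut i N) * S), ← stack_blk (Ri + Qi)]
        congr 1
        funext j
        rw [hblk, blk_add, hRi, hQi, blk_stack, blk_stack]
        split_ifs <;> simp
      rw [hsplit, one_mul]
      refine (norm_add_le _ _).trans (add_le_add_right ?_ _)
      refine norm_le_of_blk_le zero_le_one fun j => ?_
      rw [hQi, blk_stack]
      split_ifs <;> simp
    have h2 := hop.norm_mul_le hN hν Si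
    rw [hSin] at h2
    rw [hRin] at h1
    linarith
  have h1 := hR.norm_sub_le hn hG hS hN hν hop hν16
  have h2 : blk (N * R) i = blk (N * S) i + blk (N * (R - S)) i := by
    rw [← blk_add, ← Matrix.mul_add, add_sub_cancel]
  have h3 := (norm_blk_le (N * (R - S)) i).trans (hop.norm_mul_le hN hν (R - S))
  have h4 : ν * ‖R - S‖ ≤ n / 16 * ‖R - S‖ := mul_le_mul_of_nonneg_right hν16 (norm_nonneg _)
  rw [h2]
  refine (norm_add_le _ _).trans ?_
  -- Stability gives `‖R - S‖ ≤ (32/3) η`, so replacing `S` by `R` costs at most `(n/16)(32/3) η =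
  -- (2/3) η n`.
  linarith

end Certificate

/-! ### From pointwise tails to suprema by averaging over a ball. -/

section Averaging

open Metric

/-- If on the event `B` the random field `Z` is at least `s` on a ball of radius `1/4` centred in
the unit ball, then the probability of `B` is at most `5 ^ dim` times a pointwise tail bound. -/
theorem measure_le_of_forall_ball {κ X : Type*} [Fintype κ] [MeasurableSpace X] (μ : Measure X)
    [IsProbabilityMeasure μ] {Z : EuclideanSpace ℝ κ → X → ℝ}
    (hZ : Measurable (Function.uncurry Z)) {s : ℝ} {ε : ENNReal}
    (htail : ∀ u, ‖u‖ ≤ 5 / 4 → μ {x | s ≤ Z u x} ≤ ε) {B : Set X}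
    (hB : ∀ x ∈ B, ∃ v : EuclideanSpace ℝ κ, ‖v‖ ≤ 1 ∧ ∀ u ∈ ball v (1 / 4), s ≤ Z u x) :
    μ B ≤ 5 ^ Fintype.card κ * ε := by
  set ball₁ : Set (EuclideanSpace ℝ κ) := ball 0 (5 / 4) with hb₁
  set V : Measure (EuclideanSpace ℝ κ) := volume.restrict ball₁ with hV
  set D : Set (X × EuclideanSpace ℝ κ) := {p | s ≤ Z p.2 p.1} with hD
  have hDm : MeasurableSet D := measurableSet_le measurable_const (hZ.comp measurable_swap)
  set b : ENNReal := volume (ball (0 : EuclideanSpace ℝ κ) (1 / 4)) with hb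
  have hb0 : b ≠ 0 := (measure_ball_pos _ _ (by norm_num)).ne'
  have hbt : b ≠ ⊤ := measure_ball_lt_top.ne
  have hvol : volume ball₁ = 5 ^ Fintype.card κ * b := by
    have := Measure.addHaar_ball_mul_of_pos (volume : Measure (EuclideanSpace ℝ κ)) 0
      (show (0 : ℝ) < 5 by norm_num) (1 / 4)
    rw [finrank_euclideanSpace, ENNReal.ofReal_pow (by norm_num)] at this
    rw [hb₁, hb, show (5 / 4 : ℝ) = 5 * (1 / 4) by norm_num, this]
    norm_num
  -- On `B` the set of good directions has volume at least `b`, whereas by Fubini its mean volume is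
  -- at most `ε · 5 ^ dim · b`; Markov's inequality concludes. The small ball stays inside radius `1
  -- + 1/4`.
  have h1 : B ⊆ {x | b ≤ V (Prod.mk x ⁻¹' D)} := by
    intro x hx
    obtain ⟨v, hv, hu⟩ := hB x hx
    change b ≤ V (Prod.mk x ⁻¹' D)
    rw [hV, Measure.restrict_apply (measurable_prodMk_left hDm), hb,
      ← Measure.addHaar_ball_center volume v]
    refine measure_mono fun u hu' => ⟨hu u hu', ?_⟩
    rw [hb₁, mem_ball_zero_iff]
    have h2 : ‖u - v‖ < 1 / 4 := by rwa [mem_ball, dist_eq_norm] at hu'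
    have h3 := norm_le_norm_add_norm_sub' u v
    linarith
  have h2 : ∫⁻ x, V (Prod.mk x ⁻¹' D) ∂μ ≤ ε * (5 ^ Fintype.card κ * b) := by
    rw [← Measure.prod_apply hDm, Measure.prod_apply_symm hDm, hV]
    calc ∫⁻ u in ball₁, μ ((fun x => (x, u)) ⁻¹' D) ≤ ∫⁻ _ in ball₁, ε := by
          refine setLIntegral_mono measurable_const fun u hu => htail u ?_
          rw [hb₁, mem_ball_zero_iff] at hu
          exact hu.le
      _ = ε * (5 ^ Fintype.card κ * b) := by rw [setLIntegral_const, hvol]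
  have h3 := mul_meas_ge_le_lintegral (μ := μ) (measurable_measure_prodMk_left (ν := V) hDm) b
  have h4 : b * μ B ≤ b * (5 ^ Fintype.card κ * ε) :=
    (mul_le_mul_right (measure_mono h1) b).trans (h3.trans (h2.trans (le_of_eq (by ring))))
  exact (ENNReal.mul_le_mul_iff_right hb0 hbt).1 h4

end Averaging

/-! ### Gaussian tails of linear forms. -/

section SubGaussian

theorem hasSubgaussianMGF_id_gaussianReal :
    HasSubgaussianMGF (fun y : ℝ => y) 1 (gaussianReal 0 1) := by
  refine ⟨fun t => integrable_exp_mul_gaussianReal t, fun t => ?_⟩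
  rw [mgf_fun_id_gaussianReal]
  simp

/-- The standard Gaussian measure on `ℝ^ι`. -/
noncomputable abbrev stdGauss (ι : Type*) [Fintype ι] : Measure (ι → ℝ) :=
  Measure.pi fun _ => gaussianReal 0 1

theorem stdGauss_linear_tail {ι : Type*} [Fintype ι] (c : ι → ℝ) {V : ℝ} (hV : 0 ≤ V)
    (hc : ∑ e, c e ^ 2 ≤ V) {s : ℝ} (hs : 0 ≤ s) :
    stdGauss ι {x | s ≤ ∑ e, c e * x e} ≤ ENNReal.ofReal (Real.exp (-s ^ 2 / (2 * V))) := by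
  have hind : iIndepFun (fun e (x : ι → ℝ) => c e * x e) (stdGauss ι) :=
    iIndepFun_pi (X := fun e (y : ℝ) => c e * y) fun e => by fun_prop
  have hcoord : ∀ e, HasSubgaussianMGF (fun x : ι → ℝ => x e) 1 (stdGauss ι) := by
    intro e
    have h := (measurePreserving_eval (fun _ : ι => gaussianReal 0 1) e)
    refine HasSubgaussianMGF.of_map (Y := fun x : ι → ℝ => x e) (X := fun y => y)
      (measurable_pi_apply e).aemeasurable ?_
    have he : Measure.map (fun x : ι → ℝ => x e) (stdGauss ι) = gaussianReal 0 1 := h.map_eq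
    rw [he]
    exact hasSubgaussianMGF_id_gaussianReal
  have hsum := HasSubgaussianMGF.sum_of_iIndepFun hind (s := Finset.univ)
    fun e _ => (hcoord e).const_mul (c e)
  have hV' : HasSubgaussianMGF (fun x : ι → ℝ => ∑ e, c e * x e) ⟨V, hV⟩ (stdGauss ι) := by
    refine ⟨hsum.integrable_exp_mul, fun t => (hsum.mgf_le t).trans (Real.exp_le_exp.2 ?_)⟩
    have : ((∑ e, (⟨c e ^ 2, sq_nonneg _⟩ * 1 : NNReal) : NNReal) : ℝ) ≤ V := by
      refine le_trans (le_of_eq ?_) hc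
      rw [NNReal.coe_sum]
      refine Finset.sum_congr rfl fun e _ => ?_
      exact mul_one (c e ^ 2)
    have h2 : (0 : ℝ) ≤ t ^ 2 := sq_nonneg t
    change _ ≤ V * t ^ 2 / 2
    gcongr
  have h := hV'.measure_ge_le hs
  rw [← ENNReal.ofReal_toReal (measure_ne_top (stdGauss ι) _)]
  exact ENNReal.ofReal_le_ofReal h

end SubGaussian

/-! ### Symmetric Gaussian matrices in coordinates. -/

section SymmetricNoise

variable {n d : ℕ}

/-- The positions on and above the diagonal. -/
abbrev UpperIdx (n d : ℕ) :=
  {e : (Fin n × Fin d) × (Fin n × Fin d) // toLex e.1 ≤ toLex e.2}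

/-- The position on or above the diagonal that holds the same entry of a symmetric matrix. -/
def sortIdx (z : (Fin n × Fin d) × (Fin n × Fin d)) : UpperIdx n d :=
  if h : toLex z.1 ≤ toLex z.2 then ⟨z, h⟩ else ⟨z.swap, le_of_not_ge h⟩

/-- The symmetric matrix with given entries on and above the diagonal. -/
def symmOf (x : UpperIdx n d → ℝ) : BigMatrix n d := Matrix.of fun p q => x (sortIdx (p, q))

theorem sortIdx_eq_or (z : (Fin n × Fin d) × (Fin n × Fin d)) :
    (sortIdx z).1 = z ∨ (sortIdx z).1 = z.swap := by
  unfold sortIdx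
  split_ifs
  · exact Or.inl rfl
  · exact Or.inr rfl

theorem sortIdx_swap (z : (Fin n × Fin d) × (Fin n × Fin d)) : sortIdx z.swap = sortIdx z := by
  unfold sortIdx
  simp only [Prod.fst_swap, Prod.snd_swap, Prod.swap_swap]
  split_ifs with h1 h2 h2
  · have h3 : z.1 = z.2 := toLex.injective (le_antisymm h2 h1)
    exact Subtype.ext (Prod.ext h3.symm h3)
  · rfl
  · rfl
  · exact absurd (le_of_not_ge h1) h2

theorem symmOf_transpose (x : UpperIdx n d → ℝ) : (symmOf x)ᵀ = symmOf x := by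
  ext p q
  exact congrArg x (sortIdx_swap (p, q))

theorem symmOf_upper {W : BigMatrix n d} (hW : W.IsSymm) : symmOf (fun e => W e.1.1 e.1.2) = W := by
  ext p q
  simp only [symmOf, Matrix.of_apply]
  rcases sortIdx_eq_or (p, q) with h | h
  · rw [h]
  · rw [h]
    exact hW.apply p q

/-- The coefficients of the linear form `x ↦ ⟨M, symmOf x⟩`. -/
noncomputable def upperCoef (M : BigMatrix n d) (e : UpperIdx n d) : ℝ :=
  ∑ z with sortIdx z = e, M z.1 z.2

theorem sum_mul_symmOf (M : BigMatrix n d) (x : UpperIdx n d → ℝ) :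
    ∑ p, ∑ q, M p q * symmOf x p q = ∑ e, upperCoef M e * x e := by
  rw [← Fintype.sum_prod_type' (f := fun p q => M p q * symmOf x p q),
    ← Finset.sum_fiberwise (s := Finset.univ) (g := sortIdx)]
  refine Finset.sum_congr rfl fun e _ => ?_
  rw [upperCoef, Finset.sum_mul]
  refine Finset.sum_congr rfl fun z hz => ?_
  rw [symmOf, Matrix.of_apply, (Finset.mem_filter.1 hz).2]

/-- An upper coordinate occupies at most two positions of the matrix, whence the factor `2`. -/
theorem sum_upperCoef_sq_le (M : BigMatrix n d) : ∑ e, upperCoef M e ^ 2 ≤ 2 * ‖M‖ ^ 2 := by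
  rw [frobenius_norm_sq, ← Fintype.sum_prod_type' (f := fun p q => M p q ^ 2),
    ← Finset.sum_fiberwise (s := Finset.univ) (g := sortIdx), Finset.mul_sum]
  refine Finset.sum_le_sum fun e _ => sq_sum_le_card_mul_sum_sq.trans ?_
  refine mul_le_mul_of_nonneg_right ?_ (Finset.sum_nonneg fun _ _ => sq_nonneg _)
  have hsub : (Finset.univ.filter fun z => sortIdx z = e) ⊆ {e.1, e.1.swap} := by
    intro z hz
    have h1 : sortIdx z = e := (Finset.mem_filter.1 hz).2
    rw [Finset.mem_insert, Finset.mem_singleton]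
    rcases sortIdx_eq_or z with h | h
    · left; rw [← h1, h]
    · right; rw [← h1, h, Prod.swap_swap]
  have := (Finset.card_le_card hsub).trans Finset.card_le_two
  exact_mod_cast this

theorem symmOf_bilin_tail (M : BigMatrix n d) {V : ℝ} (hV : 2 * ‖M‖ ^ 2 ≤ V) {s : ℝ}
    (hs : 0 ≤ s) :
    stdGauss (UpperIdx n d) {x | s ≤ ∑ p, ∑ q, M p q * symmOf x p q}
      ≤ ENNReal.ofReal (Real.exp (-s ^ 2 / (2 * V))) := by
  simp only [sum_mul_symmOf]
  exact stdGauss_linear_tail _ ((by positivity : 0 ≤ 2 * ‖M‖ ^ 2).trans hV)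
    ((sum_upperCoef_sq_le M).trans hV) hs

theorem continuous_symmOf_apply (p q : Fin n × Fin d) :
    Continuous fun x : UpperIdx n d → ℝ => symmOf x p q := continuous_apply _

end SymmetricNoise

/-! ### Tails of the operator norm and of a block row. -/

section OperatorNorm

open Metric

/-- If a quadratic form is not bounded by `κ`, it is large on a ball centred in the unit ball. -/
theorem exists_ball_of_not_opBound {m : Type*} [Fintype m] {N : Matrix m m ℝ} {κ : ℝ}
    (h : ¬ OpBound N κ) : ∃ v : EuclideanSpace ℝ m, ‖v‖ ≤ 1 ∧
      ∀ u ∈ ball v (1 / 4), 5 / 16 * κ ≤ |u.ofLp ⬝ᵥ (N *ᵥ u.ofLp)| := by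
  set q : EuclideanSpace ℝ m → ℝ := fun u => u.ofLp ⬝ᵥ (N *ᵥ u.ofLp) with hq
  have hnorm : ∀ u : EuclideanSpace ℝ m, u.ofLp ⬝ᵥ u.ofLp = ‖u‖ ^ 2 := by
    intro u
    rw [EuclideanSpace.real_norm_sq_eq]
    simp only [dotProduct, sq]
  have hsmul : ∀ (c : ℝ) u, q (c • u) = c ^ 2 * q u := by
    intro c u
    simp only [hq, WithLp.ofLp_smul, Matrix.mulVec_smul, dotProduct_smul, smul_dotProduct,
      smul_eq_mul]
    ring
  have hpar : ∀ u w, q (u + w) + q (u - w) = 2 * q u + 2 * q w := by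
    intro u w
    simp only [hq, WithLp.ofLp_add, WithLp.ofLp_sub, Matrix.mulVec_add, Matrix.mulVec_sub,
      dotProduct_add, add_dotProduct, dotProduct_sub, sub_dotProduct]
    ring
  have hcont : Continuous q := by
    simp only [hq, dotProduct, Matrix.mulVec]
    fun_prop
  obtain ⟨v, hv, hmax⟩ := (isCompact_closedBall (0 : EuclideanSpace ℝ m) 1).exists_isMaxOn
    ⟨0, by simp⟩ hcont.abs.continuousOn
  have hv1 : ‖v‖ ≤ 1 := by simpa using hv
  set t := |q v| with ht
  have ht0 : 0 ≤ t := abs_nonneg _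
  have hbound : ∀ u, |q u| ≤ t * ‖u‖ ^ 2 := by
    intro u
    rcases eq_or_ne u 0 with rfl | hu
    · simp [hq]
    · have hu' : 0 < ‖u‖ := norm_pos_iff.2 hu
      have h1 : |q (‖u‖⁻¹ • u)| ≤ t := hmax (by simp [norm_smul, hu'.ne'])
      rw [hsmul, abs_mul, abs_of_nonneg (by positivity), inv_pow,
        inv_mul_le_iff₀ (by positivity)] at h1
      linarith
  have hκ : κ < t := by
    by_contra! hle
    refine h fun x => ?_
    have h1 := hbound (WithLp.toLp 2 x)
    rw [← hnorm] at h1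
    refine h1.trans (mul_le_mul_of_nonneg_right hle ?_)
    rw [hnorm]; positivity
  refine ⟨v, hv1, fun u hu => ?_⟩
  have hw : ‖u - v‖ ≤ 1 / 4 := by rw [mem_ball, dist_eq_norm] at hu; exact hu.le
  -- Parallelogram law around the maximizer `v`: `2 q(v) = q(u) + q(2v - u) - 2 q(u - v)`, so
  -- `|q(u)| ≥ (2 - 25/16 - 2/16) t`.
  have h1 := hpar v (u - v)
  rw [add_sub_cancel] at h1
  have h2 := hbound (u - v)
  have h3 := hbound (v - (u - v))
  have h4 : ‖v - (u - v)‖ ≤ 5 / 4 := (norm_sub_le _ _).trans (by linarith)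
  have h5 : t * ‖u - v‖ ^ 2 ≤ t * (1 / 4) ^ 2 := by gcongr
  have h6 : t * ‖v - (u - v)‖ ^ 2 ≤ t * (5 / 4) ^ 2 := by gcongr
  have h7 : 2 * t ≤ |q u| + |q (v - (u - v))| + 2 * |q (u - v)| := by
    have e : 2 * q v = q u + q (v - (u - v)) + -(2 * q (u - v)) := by linarith
    calc 2 * t = |2 * q v| := by rw [abs_mul, abs_of_pos (by norm_num : (0 : ℝ) < 2)]
      _ ≤ |q u| + |q (v - (u - v))| + |-(2 * q (u - v))| := by
          rw [e]; exact abs_add_three _ _ _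
      _ = _ := by rw [abs_neg, abs_mul, abs_of_pos (by norm_num : (0 : ℝ) < 2)]
  change 5 / 16 * κ ≤ |q u|
  linarith

variable {n d : ℕ}

theorem measure_not_opBound_le {κ : ℝ} (hκ : 0 ≤ κ) :
    stdGauss (UpperIdx n d) {x | ¬ OpBound (symmOf x) κ}
      ≤ 5 ^ (n * d) * (2 * ENNReal.ofReal (Real.exp (-(5 / 16 * κ) ^ 2 / 10))) := by
  have hcard : Fintype.card (Fin n × Fin d) = n * d := by simp
  rw [← hcard]
  refine measure_le_of_forall_ball (κ := Fin n × Fin d) _ (s := 5 / 16 * κ)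
    (Z := fun u x => |u.ofLp ⬝ᵥ (symmOf x *ᵥ u.ofLp)|) ?_ (fun u hu => ?_)
    fun x hx => exists_ball_of_not_opBound hx
  · apply Continuous.measurable
    simp only [Function.uncurry_def, dotProduct, Matrix.mulVec, symmOf, Matrix.of_apply]
    fun_prop
  · have hform : ∀ x : UpperIdx n d → ℝ, u.ofLp ⬝ᵥ (symmOf x *ᵥ u.ofLp)
        = ∑ p, ∑ q, Matrix.vecMulVec u.ofLp u.ofLp p q * symmOf x p q := by
      intro x
      simp only [dotProduct, Matrix.mulVec, Finset.mul_sum, Matrix.vecMulVec_apply]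
      exact Finset.sum_congr rfl fun p _ => Finset.sum_congr rfl fun q _ => by ring
    have hnorm : ‖Matrix.vecMulVec u.ofLp u.ofLp‖ ^ 2 = (‖u‖ ^ 2) ^ 2 := by
      rw [frobenius_norm_sq, EuclideanSpace.real_norm_sq_eq, sq (∑ i, _), Finset.sum_mul_sum]
      simp only [Matrix.vecMulVec_apply, mul_pow]
    have hV : 2 * ‖Matrix.vecMulVec u.ofLp u.ofLp‖ ^ 2 ≤ 5 := by
      rw [hnorm, ← pow_mul]
      have := pow_le_pow_left₀ (norm_nonneg _) hu (2 * 2)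
      norm_num at this ⊢
      linarith
    have hV' : 2 * ‖-Matrix.vecMulVec u.ofLp u.ofLp‖ ^ 2 ≤ 5 := by rwa [norm_neg]
    have h1 := symmOf_bilin_tail _ hV (show 0 ≤ 5 / 16 * κ by positivity)
    have h2 := symmOf_bilin_tail _ hV' (show 0 ≤ 5 / 16 * κ by positivity)
    have hsub : {x : UpperIdx n d → ℝ | 5 / 16 * κ ≤ |u.ofLp ⬝ᵥ (symmOf x *ᵥ u.ofLp)|}
        ⊆ {x | 5 / 16 * κ ≤ ∑ p, ∑ q, Matrix.vecMulVec u.ofLp u.ofLp p q * symmOf x p q}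
          ∪ {x | 5 / 16 * κ ≤ ∑ p, ∑ q, (-Matrix.vecMulVec u.ofLp u.ofLp) p q * symmOf x p q} := by
      intro x hx
      simp only [Set.mem_ofPred_eq, Set.mem_union, Matrix.neg_apply, neg_mul,
        Finset.sum_neg_distrib, ← hform] at hx ⊢
      exact le_abs.1 hx
    refine (measure_mono hsub).trans ((measure_union_le _ _).trans ?_)
    rw [two_mul]
    norm_num at h1 h2 ⊢
    exact add_le_add h1 h2

/-- The norm of the block is a supremum of linear forms in the noise over `d²` dimensions. As `Sᵀ S
= n I`, each has variance at most `2n ‖u‖² ≤ 25n/8`. -/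
theorem measure_norm_blk_ge_le {S : Stack n d} (hS : Sᵀ * S = (n : ℝ) • 1) (i : Fin n) {t : ℝ}
    (ht : 0 < t) :
    stdGauss (UpperIdx n d) {x | t ≤ ‖blk (symmOf x * S) i‖}
      ≤ 5 ^ (d * d) * ENNReal.ofReal (Real.exp (-(3 / 4 * t) ^ 2 / (25 / 4 * n))) := by
  have hcard : Fintype.card (Fin d × Fin d) = d * d := by simp
  rw [← hcard]
  set Y : (UpperIdx n d → ℝ) → EuclideanSpace ℝ (Fin d × Fin d) :=
    fun x => WithLp.toLp 2 fun ab => blk (symmOf x * S) i ab.1 ab.2 with hY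
  have hYn : ∀ x, ‖Y x‖ = ‖blk (symmOf x * S) i‖ := by
    intro x
    rw [← sq_eq_sq₀ (norm_nonneg _) (norm_nonneg _), EuclideanSpace.real_norm_sq_eq,
      frobenius_norm_sq, Fintype.sum_prod_type]
  have hYc : Continuous Y := by
    refine (PiLp.continuous_toLp 2 _).comp (continuous_pi fun ab => ?_)
    simp only [blk, Matrix.of_apply, Matrix.mul_apply, symmOf]
    fun_prop
  refine measure_le_of_forall_ball (κ := Fin d × Fin d) _ (s := 3 / 4 * t)
    (Z := fun u x => inner ℝ u (Y x)) ?_ (fun u hu => ?_) fun x hx => ?_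
  · apply Continuous.measurable
    simp only [Function.uncurry_def]
    fun_prop
  · set U : Matrix (Fin d) (Fin d) ℝ := Matrix.of fun a b => u (a, b) with hU
    set M : BigMatrix n d := Matrix.of fun p q => if p.1 = i then (U * Sᵀ) p.2 q else 0 with hM
    have hUn : ‖U‖ ^ 2 = ‖u‖ ^ 2 := by
      rw [EuclideanSpace.real_norm_sq_eq, frobenius_norm_sq, Fintype.sum_prod_type]
      rfl
    have hMn : ‖M‖ ^ 2 = n * ‖U‖ ^ 2 := by
      have h1 : ‖M‖ ^ 2 = ‖U * Sᵀ‖ ^ 2 := by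
        rw [frobenius_norm_sq, frobenius_norm_sq, Fintype.sum_prod_type,
          Finset.sum_eq_single i]
        · simp [hM]
        · intro j _ hj; simp [hM, hj]
        · simp
      rw [h1, ← Matrix.frobenius_norm_transpose, Matrix.transpose_mul, Matrix.transpose_transpose,
        frobenius_norm_sq_mul_left hS, Matrix.frobenius_norm_transpose]
    have hform : ∀ x, inner ℝ u (Y x) = ∑ p, ∑ q, M p q * symmOf x p q := by
      intro x
      have h1 : ∑ p, ∑ q, M p q * symmOf x p q
          = ∑ a, ∑ q, (U * Sᵀ) a q * symmOf x (i, a) q := by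
        rw [Fintype.sum_prod_type, Finset.sum_eq_single i]
        · simp [hM]
        · intro j _ hj; simp [hM, hj]
        · simp
      rw [h1]
      rw [PiLp.inner_apply, Fintype.sum_prod_type]
      simp only [hY, blk, Matrix.of_apply, Matrix.mul_apply, hU, Matrix.transpose_apply,
        Finset.sum_mul, RCLike.inner_apply, conj_trivial]
      refine Finset.sum_congr rfl fun a _ => ?_
      rw [Finset.sum_comm]
      exact Finset.sum_congr rfl fun q _ => Finset.sum_congr rfl fun b _ => by ring
    have hV : 2 * ‖M‖ ^ 2 ≤ 25 / 8 * n := by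
      rw [hMn, hUn]
      have h1 : ‖u‖ ^ 2 ≤ (5 / 4) ^ 2 := pow_le_pow_left₀ (norm_nonneg _) hu 2
      have h2 : (0 : ℝ) ≤ n := Nat.cast_nonneg n
      nlinarith
    have h1 := symmOf_bilin_tail _ hV (show 0 ≤ 3 / 4 * t by positivity)
    simp only [hform]
    refine h1.trans (le_of_eq ?_)
    congr 3
    ring
  · have hx' : t ≤ ‖Y x‖ := by rw [hYn]; exact hx
    have hpos : 0 < ‖Y x‖ := ht.trans_le hx'
    -- The normalized block attains its norm; moving it by less than `1/4` loses at most a quarter.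
    refine ⟨‖Y x‖⁻¹ • Y x, by simp [norm_smul, hpos.ne'], fun u hu => ?_⟩
    rw [mem_ball, dist_eq_norm] at hu
    have e : inner ℝ u (Y x) = ‖Y x‖ + inner ℝ (u - ‖Y x‖⁻¹ • Y x) (Y x) := by
      rw [inner_sub_left, real_inner_smul_left, real_inner_self_eq_norm_sq]
      field_simp
      ring
    have h1 := (abs_le.1 (abs_real_inner_le_norm (u - ‖Y x‖⁻¹ • Y x) (Y x))).1
    change 3 / 4 * t ≤ inner ℝ u (Y x)
    rw [e]
    nlinarith

end OperatorNorm

/-! ### Independence and measurability of the leave-one-out fixed points. -/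

section CanonicalSpace

section LeaveOneOut

variable {ι : Type*} [DecidableEq ι]

/-- Keep the coordinates in `T`. -/
def restrictCoord (T : Finset ι) (x : ι → ℝ) : ι → ℝ := fun e => if e ∈ T then x e else 0

theorem continuous_restrictCoord (T : Finset ι) : Continuous (restrictCoord T) := by
  refine continuous_pi fun e => ?_
  unfold restrictCoord
  split_ifs
  · exact continuous_apply e
  · exact continuous_const

theorem measurable_restrictCoord [Fintype ι] (T : Finset ι) : Measurable (restrictCoord T) :=
  (continuous_restrictCoord T).measurable

theorem indepFun_restrictCoord [Fintype ι] (T : Finset ι) :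
    IndepFun (restrictCoord T) (restrictCoord Tᶜ) (stdGauss ι) := by
  have hind : iIndepFun (fun e (x : ι → ℝ) => x e) (stdGauss ι) :=
    iIndepFun_pi (X := fun _ (y : ℝ) => y) fun e => aemeasurable_id
  have h := hind.indepFun_finset T Tᶜ disjoint_compl_right fun e => measurable_pi_apply e
  have hext : ∀ S : Finset ι, Measurable fun (y : S → ℝ) (e : ι) =>
      if h : e ∈ S then y ⟨e, h⟩ else 0 := by
    intro S
    refine measurable_pi_lambda _ fun e => ?_
    split_ifs with he
    · exact measurable_pi_apply _
    · exact measurable_const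
  have h2 := h.comp (hext T) (hext Tᶜ)
  have e1 : ∀ S : Finset ι, ((fun (y : S → ℝ) (e : ι) => if h : e ∈ S then y ⟨e, h⟩ else 0) ∘
      fun (x : ι → ℝ) (e : S) => x e) = restrictCoord S := by
    intro S
    funext x e
    simp [restrictCoord]
  rwa [e1, e1] at h2

/-- A tail bound that holds for each frozen value of one of two independent variables holds
jointly. -/
theorem measure_joint_le_of_indepFun {Ω α β : Type*} [MeasurableSpace Ω] [MeasurableSpace α]
    [MeasurableSpace β] {μ : Measure Ω} [IsProbabilityMeasure μ] {X : Ω → α} {Y : Ω → β}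
    (hX : Measurable X) (hY : Measurable Y) (h : IndepFun X Y μ) {B : Set (α × β)}
    (hB : MeasurableSet B) {ε : ENNReal} (hε : ∀ y, μ {ω | (X ω, y) ∈ B} ≤ ε) :
    μ {ω | (X ω, Y ω) ∈ B} ≤ ε := by
  have h1 := (indepFun_iff_map_prod_eq_prod_map_map hX.aemeasurable hY.aemeasurable).1 h
  have h2 : μ {ω | (X ω, Y ω) ∈ B} = μ.map (fun ω => (X ω, Y ω)) B :=
    (Measure.map_apply (hX.prodMk hY) hB).symm
  have : IsProbabilityMeasure (μ.map X) := Measure.isProbabilityMeasure_map hX.aemeasurable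
  have : IsProbabilityMeasure (μ.map Y) := Measure.isProbabilityMeasure_map hY.aemeasurable
  rw [h2, h1, Measure.prod_apply_symm hB]
  calc ∫⁻ y, μ.map X ((fun x => (x, y)) ⁻¹' B) ∂(μ.map Y) ≤ ∫⁻ _, ε ∂(μ.map Y) := by
        refine lintegral_mono fun y => ?_
        rw [Measure.map_apply hX (measurable_prodMk_right hB)]
        exact hε y
    _ = ε := by simp

end LeaveOneOut

variable {n d : ℕ}

/-- The positions that meet the `i`-th block row or column. -/
def crossIdx (i : Fin n) : Finset (UpperIdx n d) :=
  Finset.univ.filter fun e => e.1.1.1 = i ∨ e.1.2.1 = i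

theorem sortIdx_mem_crossIdx (i : Fin n) (p q : Fin n × Fin d) :
    sortIdx (p, q) ∈ crossIdx i ↔ p.1 = i ∨ q.1 = i := by
  rw [crossIdx, Finset.mem_filter]
  rcases sortIdx_eq_or (p, q) with h | h
  · simp [h]
  · simp [h, or_comm]

theorem symmOf_restrictCoord_compl (i : Fin n) (x : UpperIdx n d → ℝ) :
    symmOf (restrictCoord (crossIdx i)ᶜ x) = leaveOut i (symmOf x) := by
  ext p q
  simp only [symmOf, restrictCoord, leaveOut, Matrix.of_apply, Finset.mem_compl,
    sortIdx_mem_crossIdx]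
  split_ifs <;> simp_all

theorem blk_symmOf_restrictCoord_mul (i : Fin n) (x : UpperIdx n d → ℝ) (S : Stack n d) :
    blk (symmOf (restrictCoord (crossIdx i) x) * S) i = blk (symmOf x * S) i := by
  ext a b
  simp only [blk, Matrix.of_apply, Matrix.mul_apply, symmOf, restrictCoord, sortIdx_mem_crossIdx,
    true_or, if_true]

open Classical in
/-- The clipped fixed point for the noise `σ • symmOf x` where the noise has norm at most `κ`, and
`G` elsewhere. -/
noncomputable def fixOf (G : Stack n d) (σ κ : ℝ) (x : UpperIdx n d → ℝ) : Stack n d :=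
  if h : OpBound (symmOf x) κ ∧ ∃ R, IsClippedFix G (σ • symmOf x) R then h.2.choose else G

theorem isOrth_fixOf {G : Stack n d} (hG : IsOrth (blk G)) (σ κ : ℝ) (x : UpperIdx n d → ℝ) :
    IsOrth (blk (fixOf G σ κ x)) := by
  unfold fixOf
  split_ifs with h
  · exact h.2.choose_spec.1.1
  · exact hG

theorem smul_symmOf_transpose (σ : ℝ) (x : UpperIdx n d → ℝ) :
    (σ • symmOf x)ᵀ = σ • symmOf x := by
  rw [Matrix.transpose_smul, symmOf_transpose]

theorem isClippedFix_fixOf (hn : 0 < n) (hd : 0 < d) {G : Stack n d} (hG : IsOrth (blk G))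
    {σ κ : ℝ} (hσ : 0 ≤ σ) (hκ : 0 ≤ κ) (hsmall : σ * κ * √d ≤ n / 16) {x : UpperIdx n d → ℝ}
    (hx : OpBound (symmOf x) κ) : IsClippedFix G (σ • symmOf x) (fixOf G σ κ x) := by
  have hd1 : 1 ≤ √(d : ℝ) := by rw [Real.one_le_sqrt]; exact_mod_cast hd
  have hσκ : 0 ≤ σ * κ := mul_nonneg hσ hκ
  have h : OpBound (symmOf x) κ ∧ ∃ R, IsClippedFix G (σ • symmOf x) R :=
    ⟨hx, exists_isClippedFix hn hG (smul_symmOf_transpose σ x) hσκ (hx.smul hσ)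
      (by nlinarith) hsmall⟩
  rw [fixOf, dif_pos h]
  exact h.2.choose_spec

theorem isClosed_opBound (κ : ℝ) : IsClosed {x : UpperIdx n d → ℝ | OpBound (symmOf x) κ} := by
  have : {x : UpperIdx n d → ℝ | OpBound (symmOf x) κ}
      = ⋂ u : Fin n × Fin d → ℝ, {x | |u ⬝ᵥ (symmOf x *ᵥ u)| ≤ κ * (u ⬝ᵥ u)} := by
    ext x; simp [OpBound]
  rw [this]
  refine isClosed_iInter fun u => isClosed_le ?_ continuous_const
  simp only [dotProduct, Matrix.mulVec, symmOf, Matrix.of_apply]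
  fun_prop

/-- Stability makes the chosen fixed point Lipschitz in the noise. This gives the measurability that
the Fubini argument over the independent row needs. -/
theorem continuousOn_fixOf (hn : 0 < n) (hd : 0 < d) {G : Stack n d} (hG : IsOrth (blk G))
    {σ κ : ℝ} (hσ : 0 ≤ σ) (hκ : 0 ≤ κ) (hsmall : σ * κ * √d ≤ n / 16) :
    ContinuousOn (fixOf G σ κ) {x | OpBound (symmOf x) κ} := by
  have hn' : (0 : ℝ) < n := by exact_mod_cast hn
  have hd1 : 1 ≤ √(d : ℝ) := by rw [Real.one_le_sqrt]; exact_mod_cast hd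
  have hσκ : 0 ≤ σ * κ := mul_nonneg hσ hκ
  intro y hy
  refine tendsto_iff_norm_sub_tendsto_zero.2 ?_
  have hlip : ∀ x ∈ {x | OpBound (symmOf x) κ}, ‖fixOf G σ κ x - fixOf G σ κ y‖
      ≤ 16 / (3 * n) * (‖σ • symmOf x - σ • symmOf y‖ * (√n * √d)) := by
    intro x hx
    have h1 := (isClippedFix_fixOf hn hd hG hσ hκ hsmall hx).norm_sub_le hn hG
      (isClippedFix_fixOf hn hd hG hσ hκ hsmall hy) (smul_symmOf_transpose σ x) hσκ (hx.smul hσ)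
      (by nlinarith)
    have h2 := Matrix.frobenius_norm_mul (σ • symmOf x - σ • symmOf y) (fixOf G σ κ y)
    rw [(isOrth_fixOf hG σ κ y).norm_eq] at h2
    rw [div_mul_eq_mul_div, le_div_iff₀ (by positivity)]
    linarith
  refine squeeze_zero' (Filter.Eventually.of_forall fun _ => norm_nonneg _)
    (eventually_nhdsWithin_of_forall hlip) ?_
  have hcont : Continuous fun x : UpperIdx n d → ℝ =>
      16 / (3 * n) * (‖σ • symmOf x - σ • symmOf y‖ * (√n * √d)) := by
    have : Continuous fun x : UpperIdx n d → ℝ => symmOf x :=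
      continuous_matrix fun p q => continuous_symmOf_apply p q
    fun_prop
  have := (hcont.tendsto y).mono_left (nhdsWithin_le_nhds (s := {x | OpBound (symmOf x) κ}))
  simpa using this

theorem measurable_fixOf_apply (hn : 0 < n) (hd : 0 < d) {G : Stack n d} (hG : IsOrth (blk G))
    {σ κ : ℝ} (hσ : 0 ≤ σ) (hκ : 0 ≤ κ) (hsmall : σ * κ * √d ≤ n / 16) (p : Fin n × Fin d)
    (c : Fin d) : Measurable fun x => fixOf G σ κ x p c := by
  classical
  set s : Set (UpperIdx n d → ℝ) := {x | OpBound (symmOf x) κ} with hs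
  have he : (fun x => fixOf G σ κ x p c) = s.piecewise (fun x => fixOf G σ κ x p c)
      fun _ => G p c := by
    funext x
    by_cases hx : x ∈ s
    · rw [Set.piecewise_eq_of_mem _ _ _ hx]
    · rw [Set.piecewise_eq_of_notMem _ _ _ hx, fixOf, dif_neg fun h => hx h.1]
  rw [he]
  refine ContinuousOn.measurable_piecewise ?_ continuousOn_const
    (isClosed_opBound κ).measurableSet
  have hent : Continuous fun R : Stack n d => R p c := continuous_id.matrix_elem p c
  exact hent.comp_continuousOn (continuousOn_fixOf hn hd hG hσ hκ hsmall)

/-- The `i`-th block row uses only coordinates in `crossIdx i` and the fixed point only the others,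
so the fixed point may be frozen. -/
theorem measure_leaveOut_row_le (hn : 0 < n) (hd : 0 < d) {G : Stack n d} (hG : IsOrth (blk G))
    {σ κ : ℝ} (hσ : 0 ≤ σ) (hκ : 0 ≤ κ) (hsmall : σ * κ * √d ≤ n / 16) (i : Fin n) {t : ℝ}
    (ht : 0 < t) :
    stdGauss (UpperIdx n d)
        {x | t ≤ ‖blk (symmOf x * fixOf G σ κ (restrictCoord (crossIdx i)ᶜ x)) i‖}
      ≤ 5 ^ (d * d) * ENNReal.ofReal (Real.exp (-(3 / 4 * t) ^ 2 / (25 / 4 * n))) := by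
  set B : Set ((UpperIdx n d → ℝ) × (UpperIdx n d → ℝ)) :=
    {z | t ≤ ‖blk (symmOf z.1 * fixOf G σ κ z.2) i‖} with hB
  have hBm : MeasurableSet B := by
    have e : B = {z | t ^ 2 ≤ ∑ a, ∑ b, (∑ q, symmOf z.1 (i, a) q * fixOf G σ κ z.2 q b) ^ 2} := by
      ext z
      simp only [hB, Set.mem_ofPred_eq]
      rw [← sq_le_sq₀ ht.le (norm_nonneg _), frobenius_norm_sq]
      rfl
    rw [e]
    refine measurableSet_le measurable_const ?_
    refine Finset.measurable_sum _ fun a _ => Finset.measurable_sum _ fun b _ => ?_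
    refine (Finset.measurable_sum _ fun q _ => ?_).pow_const 2
    exact ((continuous_symmOf_apply _ _).measurable.comp measurable_fst).mul
      ((measurable_fixOf_apply hn hd hG hσ hκ hsmall q b).comp measurable_snd)
  have h := measure_joint_le_of_indepFun (measurable_restrictCoord (crossIdx i))
    (measurable_restrictCoord (crossIdx i)ᶜ) (indepFun_restrictCoord (crossIdx (d := d) i)) hBm
    (ε := 5 ^ (d * d) * ENNReal.ofReal (Real.exp (-(3 / 4 * t) ^ 2 / (25 / 4 * n)))) (fun y => by
      simp only [hB, Set.mem_ofPred_eq, blk_symmOf_restrictCoord_mul]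
      exact measure_norm_blk_ge_le (isOrth_fixOf hG σ κ y).transpose_mul_self i ht)
  simpa only [hB, Set.mem_ofPred_eq, blk_symmOf_restrictCoord_mul] using h

/-- On the event that the noise is bounded and its rows are small on the leave-one-out fixed
points, the relaxation is tight and the estimator is blockwise accurate. -/
theorem isTight_of_rows_small (hn : 0 < n) (hd : 0 < d) {G : Stack n d} (hG : IsOrth (blk G))
    {σ κ η : ℝ} (hσ : 0 ≤ σ) (hκ : 0 ≤ κ) (hη : σ * κ * √d ≤ η * n) (hη' : η ≤ 1 / 16)
    {x : UpperIdx n d → ℝ} (hx : OpBound (symmOf x) κ)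
    (hrow : ∀ i, σ * ‖blk (symmOf x * fixOf G σ κ (restrictCoord (crossIdx i)ᶜ x)) i‖ ≤ η * n) :
    IsTight (gram (blk G) + σ • symmOf x) ∧
      ∀ R', IsMLE (gram (blk G) + σ • symmOf x) R' → BlockErrorLE R' (blk G) (3 * η) := by
  have hn' : (0 : ℝ) < n := by exact_mod_cast hn
  have hσκ : 0 ≤ σ * κ := mul_nonneg hσ hκ
  have hsmall : σ * κ * √d ≤ n / 16 := by nlinarith
  have hR := isClippedFix_fixOf hn hd hG hσ hκ hsmall hx
  refine hR.isTight_and_error hn hd hG (smul_symmOf_transpose σ x) hσκ (hx.smul hσ) hη hη'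
    fun i => ?_
  have hS := isClippedFix_fixOf hn hd hG hσ hκ hsmall (x := restrictCoord (crossIdx i)ᶜ x)
    (by rw [symmOf_restrictCoord_compl]; exact hx.leaveOut hκ i)
  have hloo : σ • symmOf (restrictCoord (crossIdx i)ᶜ x) = leaveOut i (σ • symmOf x) := by
    rw [symmOf_restrictCoord_compl]
    ext p q
    simp [leaveOut]
  rw [hloo] at hS
  refine hR.norm_blk_mul_le hn hd hG (smul_symmOf_transpose σ x) hσκ (hx.smul hσ) hη hη' hS ?_
  rw [Matrix.smul_mul, blk_smul, norm_smul, Real.norm_of_nonneg hσ]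
  exact hrow i

end CanonicalSpace

/-! ### Numerical tail bounds and transfer to an arbitrary probability space. -/

section HighProbability

variable {n d : ℕ}

theorem five_pow_le_exp (m : ℕ) : (5 : ℝ) ^ m ≤ Real.exp (2 * m) := by
  have h1 : (5 : ℝ) ≤ Real.exp 2 := by
    have h := Real.exp_one_gt_d9
    have e : Real.exp 2 = Real.exp 1 * Real.exp 1 := by rw [← Real.exp_add]; norm_num
    rw [e]; nlinarith
  calc (5 : ℝ) ^ m ≤ Real.exp 2 ^ m := pow_le_pow_left₀ (by norm_num) h1 m
    _ = Real.exp (2 * m) := by rw [← Real.exp_nat_mul, mul_comm]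

theorem five_pow_mul_exp_le {m : ℕ} {a b : ℝ} (h : a + 2 * m ≤ b) :
    (5 : ENNReal) ^ m * ENNReal.ofReal (Real.exp a) ≤ ENNReal.ofReal (Real.exp b) := by
  have e : (5 : ENNReal) ^ m = ENNReal.ofReal (5 ^ m) := by
    rw [ENNReal.ofReal_pow (by norm_num)]; norm_num
  rw [e, ← ENNReal.ofReal_mul (by positivity)]
  refine ENNReal.ofReal_le_ofReal ?_
  calc (5 : ℝ) ^ m * Real.exp a ≤ Real.exp (2 * m) * Real.exp a :=
        mul_le_mul_of_nonneg_right (five_pow_le_exp m) (Real.exp_nonneg _)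
    _ = Real.exp (a + 2 * m) := by rw [← Real.exp_add, add_comm]
    _ ≤ Real.exp b := Real.exp_le_exp.2 h

/-- With high probability the symmetric Gaussian matrix has norm at most `24 √(nd)`. -/
theorem measure_not_opBound_sqrt_le (hn : 0 < n) (hd : 0 < d) :
    stdGauss (UpperIdx n d) {x | ¬ OpBound (symmOf x) (24 * (√n * √d))}
      ≤ ENNReal.ofReal (2 / (n : ℝ) ^ 2) := by
  have hn' : (0 : ℝ) < n := by exact_mod_cast hn
  have hd' : (1 : ℝ) ≤ d := by exact_mod_cast hd
  refine (measure_not_opBound_le (by positivity)).trans ?_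
  have h1 : (5 / 16 * (24 * (√(n : ℝ) * √d))) ^ 2 = (15 / 2) ^ 2 * (n * d) := by
    rw [show 5 / 16 * (24 * (√(n : ℝ) * √d)) = 15 / 2 * (√n * √d) by ring, mul_pow, mul_pow,
      Real.sq_sqrt hn'.le, Real.sq_sqrt (by positivity)]
  have h2 : Real.exp (-(2 * n)) ≤ 1 / (n : ℝ) ^ 2 := by
    have h := Real.add_one_le_exp (n : ℝ)
    have e : Real.exp (-(2 * (n : ℝ))) = 1 / (Real.exp n) ^ 2 := by
      rw [Real.exp_neg, ← Real.exp_nat_mul, one_div]; norm_num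
    rw [e]
    exact one_div_le_one_div_of_le (by positivity) (pow_le_pow_left₀ hn'.le (by linarith) 2)
  -- The exponent is `-(45/8) nd`; the volume factor costs `2nd`, and more than `2n` remains.
  have h3 := five_pow_mul_exp_le (m := n * d)
    (a := -(5 / 16 * (24 * (√(n : ℝ) * √d))) ^ 2 / 10) (b := -(2 * n)) (by
      rw [h1]
      push_cast
      nlinarith)
  calc (5 : ENNReal) ^ (n * d) * (2 * ENNReal.ofReal
          (Real.exp (-(5 / 16 * (24 * (√(n : ℝ) * √d))) ^ 2 / 10)))
      = 2 * (5 ^ (n * d) * ENNReal.ofReal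
          (Real.exp (-(5 / 16 * (24 * (√(n : ℝ) * √d))) ^ 2 / 10))) := by ring
    _ ≤ 2 * ENNReal.ofReal (1 / (n : ℝ) ^ 2) := by
        gcongr
        exact h3.trans (ENNReal.ofReal_le_ofReal h2)
    _ = ENNReal.ofReal (2 / (n : ℝ) ^ 2) := by
        rw [show (2 : ENNReal) = ENNReal.ofReal 2 by norm_num, ← ENNReal.ofReal_mul (by norm_num)]
        congr 1
        ring

theorem row_tail_le (hn : 0 < n) (hd : 0 < d) :
    (5 : ENNReal) ^ (d * d) * ENNReal.ofReal (Real.exp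
      (-(3 / 4 * (24 * (√n * √d * (√d + √(Real.log n))))) ^ 2 / (25 / 4 * n)))
      ≤ ENNReal.ofReal (1 / (n : ℝ) ^ 3) := by
  have hn' : (0 : ℝ) < n := by exact_mod_cast hn
  have hd' : (1 : ℝ) ≤ d := by exact_mod_cast hd
  have hlog : 0 ≤ Real.log n := Real.log_natCast_nonneg n
  have h1 : (√d + √(Real.log n)) ^ 2 ≥ d + Real.log n := by
    have := mul_nonneg (Real.sqrt_nonneg (d : ℝ)) (Real.sqrt_nonneg (Real.log n))
    nlinarith [Real.sq_sqrt (Nat.cast_nonneg (α := ℝ) d), Real.sq_sqrt hlog]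
  have h2 : (3 / 4 * (24 * (√(n : ℝ) * √d * (√d + √(Real.log n))))) ^ 2
      = 324 * (n * d * (√d + √(Real.log n)) ^ 2) := by
    rw [show 3 / 4 * (24 * (√(n : ℝ) * √d * (√d + √(Real.log n))))
      = 18 * (√n * √d * (√d + √(Real.log n))) by ring, mul_pow, mul_pow, mul_pow,
      Real.sq_sqrt hn'.le, Real.sq_sqrt (by positivity)]
    norm_num
  have h3 : Real.exp (-(3 * Real.log n)) = 1 / (n : ℝ) ^ 3 := by
    rw [Real.exp_neg, show (3 : ℝ) * Real.log n = ((3 : ℕ) : ℝ) * Real.log n by norm_num,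
      Real.exp_nat_mul, Real.exp_log hn', one_div]
  rw [← h3]
  refine five_pow_mul_exp_le ?_
  rw [h2]
  have e : -(324 * (n * d * (√d + √(Real.log n)) ^ 2)) / (25 / 4 * (n : ℝ))
      = -(1296 / 25 * (d * (√d + √(Real.log n)) ^ 2)) := by
    field_simp
    ring
  rw [e]
  push_cast
  have h4 : (d : ℝ) * (d + Real.log n) ≤ d * (√d + √(Real.log n)) ^ 2 :=
    mul_le_mul_of_nonneg_left h1 (by positivity)
  have h5 : Real.log n ≤ d * Real.log n := le_mul_of_one_le_left hlog hd'
  nlinarith [mul_self_nonneg (d : ℝ)]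

/-- The law of the entries on and above the diagonal. -/
theorem IsSymmGaussian.map_eq {Ω : Type*} [MeasurableSpace Ω] {P : Measure Ω}
    [IsProbabilityMeasure P] {W : Ω → BigMatrix n d} (hW : IsSymmGaussian W P) :
    P.map (fun ω (e : UpperIdx n d) => W ω e.1.1 e.1.2) = stdGauss (UpperIdx n d) := by
  have h := (iIndepFun_iff_map_fun_eq_pi_map fun e : UpperIdx n d =>
    (hW.law e.1.1 e.1.2).aemeasurable).1 hW.indep
  rw [h]
  congr 1
  funext e
  exact (hW.law e.1.1 e.1.2).map_eq

/-- Events of a symmetric Gaussian matrix can be bounded on the canonical space. -/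
theorem IsSymmGaussian.measure_le {Ω : Type*} [MeasurableSpace Ω] {P : Measure Ω}
    [IsProbabilityMeasure P] {W : Ω → BigMatrix n d} (hW : IsSymmGaussian W P)
    (p : BigMatrix n d → Prop) :
    P {ω | p (W ω)} ≤ stdGauss (UpperIdx n d) {x | p (symmOf x)} := by
  have hae : AEMeasurable (fun ω (e : UpperIdx n d) => W ω e.1.1 e.1.2) P :=
    aemeasurable_pi_lambda _ fun e => (hW.law e.1.1 e.1.2).aemeasurable
  rw [← hW.map_eq]
  -- This inequality between outer measures spares any measurability of `p`.
  refine le_trans (measure_mono fun ω hω => ?_) (Measure.le_map_apply hae _)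
  change p (symmOf _)
  rw [symmOf_upper (hW.symm ω)]
  exact hω

end HighProbability

end OrthSync


theorem theorem1 :
    ∃ c₀ C₀ C₁ : ℝ, 0 < c₀ ∧ 0 < C₀ ∧ 0 < C₁ ∧
      ∀ (n d : ℕ), 1 ≤ n → 1 ≤ d →
      ∀ (G : Fin n → Matrix (Fin d) (Fin d) ℝ), OrthSync.IsOrth G →
      ∀ (σ : ℝ), 0 ≤ σ →
        σ < c₀ * √(n : ℝ) / (√(d : ℝ) * (√(d : ℝ) + √(Real.log n))) →
      ∀ {Ω : Type*} [MeasurableSpace Ω] (P : Measure Ω) [IsProbabilityMeasure P]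
        (W : Ω → OrthSync.BigMatrix n d), OrthSync.IsSymmGaussian W P →
        P {ω | ¬ (OrthSync.IsTight (OrthSync.observation G σ (W ω)) ∧
            ∀ R, OrthSync.IsMLE (OrthSync.observation G σ (W ω)) R →
              OrthSync.BlockErrorLE R G
                (C₀ * (σ * √((d : ℝ) / n) * (√(d : ℝ) + √(Real.log n)))))}
          ≤ ENNReal.ofReal (C₁ / (n : ℝ) ^ 2) := by
  -- With `η = 24 τ`, the condition `η ≤ 1/16` gives `1/384` and the error `3 η` gives `72`; `3 = 2
  -- + 1` adds the failure probabilities of the norm bound and of the `n` rows.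
  refine ⟨1 / 384, 72, 3, by norm_num, by norm_num, by norm_num, ?_⟩
  intro n d hn hd G hG σ hσ hσlt Ω _ P _ W hW
  have hn' : (0 : ℝ) < n := by exact_mod_cast hn
  have hd' : (0 : ℝ) < d := by exact_mod_cast hd
  have hsn : 0 < √(n : ℝ) := Real.sqrt_pos.2 hn'
  have hsd : 0 < √(d : ℝ) := Real.sqrt_pos.2 hd'
  have hsl : 0 ≤ √(Real.log n) := Real.sqrt_nonneg _
  set τ : ℝ := σ * √((d : ℝ) / n) * (√(d : ℝ) + √(Real.log n)) with hτ
  have hτn : τ * n = σ * (√n * √d * (√d + √(Real.log n))) := by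
    have h1 : (n : ℝ) / √n = √n := Real.div_sqrt
    calc τ * n = σ * √d * (n / √n) * (√d + √(Real.log n)) := by
          rw [hτ, Real.sqrt_div hd'.le]; ring
      _ = _ := by rw [h1]; ring
  have hτle : τ ≤ 1 / 384 := by
    rw [lt_div_iff₀ (by positivity)] at hσlt
    have h1 : τ * n ≤ 1 / 384 * n := by
      rw [hτn]
      calc σ * (√n * √d * (√d + √(Real.log n)))
          = √n * (σ * (√d * (√d + √(Real.log n)))) := by ring
        _ ≤ √n * (1 / 384 * √n) := mul_le_mul_of_nonneg_left hσlt.le hsn.le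
        _ = 1 / 384 * (√n * √n) := by ring
        _ = 1 / 384 * n := by rw [Real.mul_self_sqrt hn'.le]
    exact le_of_mul_le_mul_right h1 hn'
  set κ : ℝ := 24 * (√n * √d) with hκ
  have hκ0 : 0 ≤ κ := by positivity
  set t : ℝ := 24 * (√n * √d * (√d + √(Real.log n))) with ht
  have ht0 : 0 < t := by positivity
  have hη : σ * κ * √d ≤ 24 * τ * n := by
    have h1 : 0 ≤ σ * (√n * √d) * √(Real.log n) := by positivity
    rw [mul_assoc 24, hτn, hκ]
    linarith
  have hη' : 24 * τ ≤ 1 / 16 := by linarith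
  have hGs : OrthSync.IsOrth (OrthSync.blk (OrthSync.stack G)) := hG
  have hsmall : σ * κ * √d ≤ n / 16 := hη.trans (by nlinarith)
  set Bad : Fin n → Set (OrthSync.UpperIdx n d → ℝ) := fun i =>
    {x | t ≤ ‖OrthSync.blk (OrthSync.symmOf x * OrthSync.fixOf (OrthSync.stack G) σ κ
      (OrthSync.restrictCoord (OrthSync.crossIdx i)ᶜ x)) i‖} with hBad
  refine (hW.measure_le fun A => ¬ (OrthSync.IsTight (OrthSync.observation G σ A) ∧
    ∀ R, OrthSync.IsMLE (OrthSync.observation G σ A) R →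
      OrthSync.BlockErrorLE R G (72 * τ))).trans ?_
  have hsub : {x : OrthSync.UpperIdx n d → ℝ |
      ¬ (OrthSync.IsTight (OrthSync.observation G σ (OrthSync.symmOf x)) ∧
        ∀ R, OrthSync.IsMLE (OrthSync.observation G σ (OrthSync.symmOf x)) R →
          OrthSync.BlockErrorLE R G (72 * τ))}
      ⊆ {x | ¬ OrthSync.OpBound (OrthSync.symmOf x) κ} ∪ ⋃ i, Bad i := by
    intro x hx
    by_contra hgood
    rw [Set.mem_union, Set.mem_iUnion, not_or, not_exists] at hgood
    obtain ⟨h1, h2⟩ := hgood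
    refine hx ?_
    have h := OrthSync.isTight_of_rows_small hn hd hGs hσ hκ0 hη hη' (not_not.1 h1) fun i => by
      have h3 := h2 i
      simp only [hBad, Set.mem_ofPred_eq, not_le] at h3
      refine (mul_le_mul_of_nonneg_left h3.le hσ).trans (le_of_eq ?_)
      rw [ht, mul_assoc 24 τ, hτn]
      ring
    rw [show (72 : ℝ) * τ = 3 * (24 * τ) by ring]
    exact h
  refine (measure_mono hsub).trans ((measure_union_le _ _).trans ?_)
  have hrows : OrthSync.stdGauss (OrthSync.UpperIdx n d) (⋃ i, Bad i)
      ≤ ENNReal.ofReal (1 / (n : ℝ) ^ 2) := by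
    refine (measure_iUnion_fintype_le _ _).trans ?_
    calc ∑ i, OrthSync.stdGauss (OrthSync.UpperIdx n d) (Bad i)
        ≤ ∑ _i : Fin n, ENNReal.ofReal (1 / (n : ℝ) ^ 3) := Finset.sum_le_sum fun i _ =>
          (OrthSync.measure_leaveOut_row_le hn hd hGs hσ hκ0 hsmall i ht0).trans
            (OrthSync.row_tail_le hn hd)
      _ = ENNReal.ofReal (1 / (n : ℝ) ^ 2) := by
          rw [Finset.sum_const, Finset.card_univ, Fintype.card_fin, nsmul_eq_mul,
            ← ENNReal.ofReal_natCast, ← ENNReal.ofReal_mul hn'.le]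
          congr 1
          field_simp
  calc _ ≤ ENNReal.ofReal (2 / (n : ℝ) ^ 2) + ENNReal.ofReal (1 / (n : ℝ) ^ 2) :=
        add_le_add (OrthSync.measure_not_opBound_sqrt_le hn hd) hrows
    _ = ENNReal.ofReal (3 / (n : ℝ) ^ 2) := by
        rw [← ENNReal.ofReal_add (by positivity) (by positivity)]
        congr 1
        ring
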